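/- Let $k$ be a field of characteristic $0$ and let $A=A^0\oplus A^1$ be a (not necessarily unital) associative supercommutative superalgebra over $k$. For $n\ge 0$ let $D_n(A)$ be the super vector space of all supersymmetric $k$-multilinear maps $A^{n+1}\to A$ (of both parities), and let $D(A)=\prod_{n\ge 0}D_n(A)$. For $F\in D_i(A)$, $G\in D_j(A)$ put, for homogeneous $v_0,\dots,v_{i+j}$, $$(F\barwedge G)(v_0,\dots,v_{i+j})=\sum_{\sigma\in S(j+1,i)}\epsilon(\sigma)\,F\big(G(v_{\sigma(0)},\dots,v_{\sigma(j)}),v_{\sigma(j+1)},\dots,v_{\sigma(i+j)}\big),$$ where $S(p,q)$ is the set of $(p,q)$-shuffles and $\epsilon(\sigma)$ is the Koszul sign, and let $[F,G]$ be the bilinear extension of $F\barwedge G-(-1)^{|F||G|}G\barwedge F$ from homogeneous $F,G$ (the Nijenhuis–Richardson bracket). Put $\big[\sum F_i,\sum G_j\big]=\sum_{n\ge0}\sum_{i=0}^n[F_i,G_{n-i}]$ on $D(A)$. Let $\mu_n\in D_n(A)$, $\mu_n(a_0,\dots,a_n)=a_0a_1\cdots a_n$, and $\rho_n=[\mu_n,-]\colon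 D(A)\to D(A)$. Let $K_1=1$ and, for $n\ge2$, $K_n=\frac{-2}{(n+2)(n-1)}\sum_{i=1}^{n-1}S(n+1,i)K_i$, where $S(n+1,i)$ are the Stirling numbers of the second kind. For a linear map $f\colon A\to A$ the higher antibrackets $\Phi^n_f$, $n\ge 1$, are the multilinear maps in $n$ variables given on homogeneous elements by $$\Phi^n_f(a_1,\dots,a_n)=\sum_{l=1}^n(-1)^{n-l}\sum_{\sigma\in S(l,n-l)}\epsilon(\sigma)\,f(a_{\sigma(1)}\cdots a_{\sigma(l)})\,a_{\sigma(l+1)}\cdots a_{\sigma(n)}.$$ Then: 1. For every linear $f\colon A\to A$ and $n\ge1$, $\Phi^n_f$ is supersymmetric, i.e. $\Phi^n_f\in D_{n-1}(A)$; and for all linear $f,g\colon A\to A$ and all $n\ge 1$ $$\Phi^n_{[f,g]}=\sum_{i=1}^n\big[\Phi^i_f,\Phi^{n-i+1}_g\big],$$ where $[f,g]$ is the supercommutator (the bilinear extension of $fg-(-1)^{|f||g|}gf$ from homogeneous $f,g$). 2. $D(A)$ with the bracket $[-,-]$ is a Lie superalgebra, the map $\exp\big(-\sum_{n\ge1}K_n\rho_n\big)\colon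 D(A)\to D(A)$ is an automorphism of this Lie superalgebra (a parity-preserving linear bijection that respects the bracket), and it sends every linear map $f\in D_0(A)=\operatorname{Hom}^*(A,A)$ to $\sum_{i\ge1}\Phi^i_f$. 3. If $\Delta\colon A\to A$ is an odd linear map with $\Delta^2=0$, then $\sum_{i=1}^n[\Phi^i_\Delta,\Phi^{n-i+1}_\Delta]=0$ for every $n\ge1$, and the $\Phi^n_\Delta$, $n\ge 1$, are the Taylor coefficients of an $L_\infty$ structure ($\mathbb Z/2$-graded, after the parity shift that makes all operations odd and supersymmetric): every $\Phi^n_\Delta$ is supersymmetric and odd, and $\sum_{i=1}^n\Phi^i_\Delta\barwedge\Phi^{n-i+1}_\Delta=0$ for every $n\ge1$. -/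

import Mathlib

open scoped BigOperators

namespace Antibracket

/-! ### Abstract Lie superalgebras and their automorphisms -/

section Abstract

/-- The sign `(-1)^(c d)` for parities `c, d`. -/
def superSign (k : Type*) [Ring k] (c d : ZMod 2) : k :=
  if c = 1 ∧ d = 1 then -1 else 1

variable {k V : Type*} [Field k] [AddCommGroup V] [Module k V]

/-- The subspace `L` of `V`, graded by the even part `L ⊓ par 0` and the odd part `L ⊓ par 1`,
is a Lie superalgebra (in characteristic zero) for the bracket `br`. -/
structure IsLieSuperalgebra (L : Submodule k V) (par : ZMod 2 → Submodule k V)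
    (br : V → V → V) : Prop where
  decomp : ∀ x ∈ L, ∃! y : V × V, y.1 ∈ L ⊓ par 0 ∧ y.2 ∈ L ⊓ par 1 ∧ y.1 + y.2 = x
  closed : ∀ x ∈ L, ∀ y ∈ L, br x y ∈ L
  add_left : ∀ x ∈ L, ∀ y ∈ L, ∀ z ∈ L, br (x + y) z = br x z + br y z
  smul_left : ∀ a : k, ∀ x ∈ L, ∀ y ∈ L, br (a • x) y = a • br x y
  add_right : ∀ x ∈ L, ∀ y ∈ L, ∀ z ∈ L, br x (y + z) = br x y + br x z
  smul_right : ∀ a : k, ∀ x ∈ L, ∀ y ∈ L, br x (a • y) = a • br x y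
  parity : ∀ c d, ∀ x ∈ L ⊓ par c, ∀ y ∈ L ⊓ par d, br x y ∈ par (c + d)
  skew : ∀ c d, ∀ x ∈ L ⊓ par c, ∀ y ∈ L ⊓ par d, br x y = -(superSign k c d • br y x)
  jacobi : ∀ c d, ∀ x ∈ L ⊓ par c, ∀ y ∈ L ⊓ par d, ∀ z ∈ L,
    br x (br y z) = br (br x y) z + superSign k c d • br y (br x z)

/-- `T` restricts to an automorphism of the Lie superalgebra `L`: a parity preserving linear
bijection of `L` onto itself that respects the bracket. -/
structure IsLieSuperalgebraAut (L : Submodule k V) (par : ZMod 2 → Submodule k V)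
    (br : V → V → V) (T : V → V) : Prop where
  bijOn : Set.BijOn T (L : Set V) (L : Set V)
  map_add : ∀ x ∈ L, ∀ y ∈ L, T (x + y) = T x + T y
  map_smul : ∀ a : k, ∀ x ∈ L, T (a • x) = a • T x
  map_parity : ∀ c, ∀ x ∈ L ⊓ par c, T x ∈ par c
  map_bracket : ∀ x ∈ L, ∀ y ∈ L, T (br x y) = br (T x) (T y)

end Abstract

/-! ### Multilinear operators on a super vector space -/

section Operators

/-- Multilinear operators of `n + 1` variables on `A`. -/
abbrev Op (k A : Type*) [Field k] [AddCommGroup A] [Module k A] (n : ℕ) : Type _ :=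
  MultilinearMap k (fun _ : Fin (n + 1) => A) A

/-- Sequences of multilinear operators, the `n`-th one in `n + 1` variables. -/
abbrev OpSeq (k A : Type*) [Field k] [AddCommGroup A] [Module k A] : Type _ :=
  (n : ℕ) → Op k A n

variable {k A : Type*} [Field k] [AddCommGroup A] [Module k A]

/-- Supersymmetric operators: exchanging two adjacent homogeneous arguments produces the
sign `(-1)^(|a_i| |a_{i+1}|)`. -/
def supersymmetric (𝒜 : ZMod 2 → Submodule k A) (n : ℕ) : Submodule k (Op k A n) where
  carrier := {F | ∀ (p : Fin (n + 1) → ZMod 2) (v : Fin (n + 1) → A), (∀ i, v i ∈ 𝒜 (p i)) →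
    ∀ i j : Fin (n + 1), (j : ℕ) = i + 1 →
      F v = superSign k (p i) (p j) • F (fun l => v (Equiv.swap i j l))}
  add_mem' := by
    intro F G hF hG p v hv i j hij
    rw [add_apply, add_apply, hF p v hv i j hij,
      hG p v hv i j hij, smul_add]
  zero_mem' := by
    intro p v hv i j hij
    simp
  smul_mem' := by
    intro c F hF p v hv i j hij
    rw [smul_apply, smul_apply, hF p v hv i j hij, smul_comm]

/-- Operators of parity `d`. -/
def opOfParity (𝒜 : ZMod 2 → Submodule k A) (d : ZMod 2) (n : ℕ) : Submodule k (Op k A n) where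
  carrier := {F | ∀ (p : Fin (n + 1) → ZMod 2) (v : Fin (n + 1) → A), (∀ i, v i ∈ 𝒜 (p i)) →
    F v ∈ 𝒜 (d + ∑ i, p i)}
  add_mem' := by
    intro F G hF hG p v hv
    exact Submodule.add_mem _ (hF p v hv) (hG p v hv)
  zero_mem' := by
    intro p v hv
    exact Submodule.zero_mem _
  smul_mem' := by
    intro c F hF p v hv
    exact Submodule.smul_mem _ c (hF p v hv)

/-- `D(A) = ∏_{n ≥ 0} D_n(A)`, where `D_n(A)` are the supersymmetric operators of `n + 1`
variables. -/
def D (𝒜 : ZMod 2 → Submodule k A) : Submodule k (OpSeq k A) :=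
  Submodule.pi Set.univ (fun n => supersymmetric 𝒜 n)

/-- Sequences of operators all of which have parity `d`. -/
def seqOfParity (𝒜 : ZMod 2 → Submodule k A) (d : ZMod 2) : Submodule k (OpSeq k A) :=
  Submodule.pi Set.univ (fun n => opOfParity 𝒜 d n)

/-- Linear endomorphisms of `A` of parity `d`. -/
def IsLinearOfParity (𝒜 : ZMod 2 → Submodule k A) (d : ZMod 2) (f : A →ₗ[k] A) : Prop :=
  ∀ c, ∀ a ∈ 𝒜 c, f a ∈ 𝒜 (d + c)

/-- The operator `(v_0, …, v_n) ↦ F (G (v_0, …, v_j), v_{j+1}, …, v_n)`, where `i + j = n`. -/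
def insertFirst {i j n : ℕ} (h : i + j = n) (F : Op k A i) (G : Op k A j) : Op k A n :=
  (MultilinearMap.uncurrySum (N := fun _ : Fin (j + 1) ⊕ Fin i => A)
      (F.curryLeft.compMultilinearMap G)).domDomCongr
    (finSumFinEquiv.trans (finCongr (by omega)))

theorem insertFirst_apply {i j n : ℕ} (h : i + j = n) (F : Op k A i) (G : Op k A j)
    (v : Fin (n + 1) → A) :
    insertFirst h F G v =
      F (Fin.cons (G fun a : Fin (j + 1) => v ⟨a, by omega⟩)
        (fun b : Fin i => v ⟨j + 1 + b, by omega⟩)) :=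
  rfl

/-- The Koszul sign of the permutation `σ` for arguments of parities `p`: `-1` to the number of
pairs of positions `i < j` for which the arguments numbered `σ i` and `σ j`, placed there by `σ`,
are both odd and have been exchanged. -/
def koszulSign (k : Type*) [Ring k] {N : ℕ} (σ : Equiv.Perm (Fin N)) (p : Fin N → ZMod 2) : k :=
  (-1) ^ (Finset.univ.filter fun x : Fin N × Fin N =>
    x.1 < x.2 ∧ σ x.2 < σ x.1 ∧ p (σ x.1) = 1 ∧ p (σ x.2) = 1).card

/-- The shuffles of type `(a, N - a)`: permutations of `0, …, N - 1` that are increasing on the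
first `a` and on the last `N - a` positions. -/
def shuffles (a N : ℕ) : Finset (Equiv.Perm (Fin N)) :=
  open Classical in Finset.univ.filter fun σ =>
    (∀ x y : Fin N, x < y → (y : ℕ) < a → σ x < σ y) ∧
    (∀ x y : Fin N, x < y → a ≤ (x : ℕ) → σ x < σ y)

variable (𝒜 : ZMod 2 → Submodule k A) [DirectSum.Decomposition 𝒜]

/-- The projection of `A` onto its component of parity `c`. -/
def parityProj (c : ZMod 2) : A →ₗ[k] A :=
  (𝒜 c).subtype ∘ₗ DirectSum.component k (ZMod 2) (fun i => 𝒜 i) c ∘ₗ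
    (DirectSum.decomposeLinearEquiv 𝒜).toLinearMap

theorem parityProj_of_mem {c : ZMod 2} {a : A} (ha : a ∈ 𝒜 c) (d : ZMod 2) :
    parityProj 𝒜 d a = if d = c then a else 0 := by
  have h0 : parityProj 𝒜 d a = (DirectSum.decompose 𝒜 a d : A) := rfl
  rw [h0]
  split_ifs with h
  · subst h
    exact DirectSum.decompose_of_mem_same 𝒜 ha
  · exact DirectSum.decompose_of_mem_ne 𝒜 ha (fun e => h e.symm)

/-- The operator given on homogeneous arguments by `v ↦ ε(σ) F (v_{σ(0)}, …, v_{σ(n)})` and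
extended multilinearly to all arguments. -/
def signedPerm {n : ℕ} (σ : Equiv.Perm (Fin (n + 1))) (F : Op k A n) : Op k A n :=
  ∑ p : Fin (n + 1) → ZMod 2,
    koszulSign k σ p • (F.domDomCongr σ).compLinearMap (fun i => parityProj 𝒜 (p i))

theorem signedPerm_apply_of_mem {n : ℕ} (σ : Equiv.Perm (Fin (n + 1))) (F : Op k A n)
    (p : Fin (n + 1) → ZMod 2) (v : Fin (n + 1) → A) (hv : ∀ i, v i ∈ 𝒜 (p i)) :
    signedPerm 𝒜 σ F v = koszulSign k σ p • F (fun i => v (σ i)) := by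
  simp only [signedPerm, sum_apply, smul_apply,
    MultilinearMap.compLinearMap_apply, MultilinearMap.domDomCongr_apply]
  rw [Finset.sum_eq_single p]
  · simp [parityProj_of_mem 𝒜 (hv _)]
  · intro q _ hq
    obtain ⟨i, hi⟩ := Function.ne_iff.mp hq
    rw [F.map_coord_zero (σ.symm i), smul_zero]
    simp [parityProj_of_mem 𝒜 (hv i), hi]
  · simp

/-- `∑_{σ ∈ S(a, n + 1 - a)} ε(σ) F (v_{σ(0)}, …, v_{σ(n)})`. -/
def shuffleSum (a : ℕ) {n : ℕ} (F : Op k A n) : Op k A n :=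
  ∑ σ ∈ shuffles a (n + 1), signedPerm 𝒜 σ F

/-- The product `F ⊼ G`, given on homogeneous arguments by
`∑_{σ ∈ S(j+1, i)} ε(σ) F (G (v_{σ(0)}, …, v_{σ(j)}), v_{σ(j+1)}, …, v_{σ(i+j)})`. -/
def wedge {i j n : ℕ} (h : i + j = n) (F : Op k A i) (G : Op k A j) : Op k A n :=
  shuffleSum 𝒜 (j + 1) (insertFirst h F G)

/-- The component of parity `d` of an operator. -/
def opPart {n : ℕ} (d : ZMod 2) (F : Op k A n) : Op k A n :=
  ∑ p : Fin (n + 1) → ZMod 2, (parityProj 𝒜 (d + ∑ i, p i)).compMultilinearMap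
    (F.compLinearMap (fun i => parityProj 𝒜 (p i)))

/-- The Nijenhuis–Richardson bracket of operators of `i + 1` and `j + 1` variables: the bilinear
extension of `F ⊼ G - (-1)^(|F| |G|) G ⊼ F` from homogeneous `F`, `G`. -/
def nrBracket {i j n : ℕ} (h : i + j = n) (F : Op k A i) (G : Op k A j) : Op k A n :=
  ∑ c : ZMod 2, ∑ d : ZMod 2,
    (wedge 𝒜 h (opPart 𝒜 c F) (opPart 𝒜 d G) -
      superSign k c d • wedge 𝒜 ((Nat.add_comm j i).trans h) (opPart 𝒜 d G) (opPart 𝒜 c F))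

theorem insertFirst_zero_left {i j n : ℕ} (h : i + j = n) (G : Op k A j) :
    insertFirst h (0 : Op k A i) G = 0 := by
  ext v
  simp [insertFirst_apply]

theorem insertFirst_zero_right {i j n : ℕ} (h : i + j = n) (F : Op k A i) :
    insertFirst h F (0 : Op k A j) = 0 := by
  ext v
  rw [insertFirst_apply]
  exact F.map_coord_zero 0 (by simp)

theorem shuffleSum_zero (a n : ℕ) : shuffleSum 𝒜 a (0 : Op k A n) = 0 := by
  refine Finset.sum_eq_zero fun σ _ => Finset.sum_eq_zero fun p _ => ?_
  ext v
  simp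

theorem opPart_zero (d : ZMod 2) (n : ℕ) : opPart 𝒜 d (0 : Op k A n) = 0 := by
  refine Finset.sum_eq_zero fun p _ => ?_
  ext v
  simp

theorem nrBracket_zero_left {i j n : ℕ} (h : i + j = n) (G : Op k A j) :
    nrBracket 𝒜 h (0 : Op k A i) G = 0 := by
  simp [nrBracket, wedge, opPart_zero, insertFirst_zero_left, insertFirst_zero_right,
    shuffleSum_zero]

theorem nrBracket_zero_right {i j n : ℕ} (h : i + j = n) (F : Op k A i) :
    nrBracket 𝒜 h F (0 : Op k A j) = 0 := by
  simp [nrBracket, wedge, opPart_zero, insertFirst_zero_left, insertFirst_zero_right,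
    shuffleSum_zero]

/-- The bracket on sequences, `[∑ F_i, ∑ G_j] = ∑_n ∑_{i=0}^n [F_i, G_{n-i}]`. -/
def seqBracket (F G : OpSeq k A) : OpSeq k A := fun n =>
  ∑ i : Fin (n + 1), nrBracket 𝒜 (Nat.add_sub_of_le i.is_le) (F i) (G (n - i))

/-- A linear endomorphism `f` of `A`, as an element of `D(A)` concentrated in `D_0(A)`. -/
def ofLinear (f : A →ₗ[k] A) : OpSeq k A :=
  Pi.single 0 (MultilinearMap.ofSubsingleton k A A (0 : Fin 1) f)

/-- The component of parity `d` of a linear endomorphism. -/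
def linearPart (d : ZMod 2) (f : A →ₗ[k] A) : A →ₗ[k] A :=
  ∑ c : ZMod 2, parityProj 𝒜 (d + c) ∘ₗ f ∘ₗ parityProj 𝒜 c

/-- The supercommutator of linear endomorphisms of `A`: the bilinear extension of
`f g - (-1)^(|f| |g|) g f` from homogeneous `f`, `g`. -/
def superCommutator (f g : A →ₗ[k] A) : A →ₗ[k] A :=
  ∑ c : ZMod 2, ∑ d : ZMod 2,
    (linearPart 𝒜 c f ∘ₗ linearPart 𝒜 d g -
      superSign k c d • (linearPart 𝒜 d g ∘ₗ linearPart 𝒜 c f))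

/-- `q` is the sequence of Taylor coefficients of an `L_∞` structure (the `ZMod 2`-graded version,
in the convention where all operations are odd and supersymmetric, that is, after the parity
shift): the operations satisfy, for every number of homogeneous arguments,
`∑_{i+j=n} ∑_{σ ∈ S(j+1, i)} ε(σ) q_i (q_j (v_{σ(0)}, …, v_{σ(j)}), v_{σ(j+1)}, …, v_{σ(n)}) = 0`. -/
structure IsLInfinityStructure (q : OpSeq k A) : Prop where
  supersymm : q ∈ D 𝒜
  odd : q ∈ seqOfParity 𝒜 1
  jacobi : ∀ n : ℕ,
    ∑ i : Fin (n + 1), wedge 𝒜 (Nat.add_sub_of_le i.is_le) (q i) (q (n - i)) = 0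

end Operators

/-! ### Higher antibrackets on a superalgebra -/

section Algebra

variable {k A : Type*} [Field k] [NonUnitalRing A] [Module k A] [IsScalarTower k A A]
  [SMulCommClass k A A]

/-- The multiplication operator `μ_n (a_0, …, a_n) = a_0 a_1 ⋯ a_n`. -/
def mulOp : (n : ℕ) → Op k A n
  | 0 => MultilinearMap.ofSubsingleton k A A (0 : Fin 1) LinearMap.id
  | n + 1 => LinearMap.uncurryLeft (M := fun _ : Fin (n + 2) => A)
      { toFun := fun a => (LinearMap.mulLeft k a).compMultilinearMap (mulOp n)
        map_add' := by
          intro a b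
          ext v
          simp [add_mul]
        map_smul' := by
          intro c a
          ext v
          simp [smul_mul_assoc] }

theorem mulOp_zero_apply (v : Fin 1 → A) : mulOp (k := k) 0 v = v 0 := rfl

theorem mulOp_succ_apply (n : ℕ) (v : Fin (n + 2) → A) :
    mulOp (k := k) (n + 1) v = v 0 * mulOp (k := k) n (fun i => v i.succ) := rfl

variable (𝒜 : ZMod 2 → Submodule k A) [DirectSum.Decomposition 𝒜]

/-- The higher antibrackets of `f`, with `higherAntibracket 𝒜 f n` the operator `Φ_f^{n+1}` of
`N = n + 1` variables: on homogeneous arguments it is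
`∑_{l=1}^N (-1)^(N-l) ∑_{σ ∈ S(l, N-l)} ε(σ) f(a_{σ(1)} ⋯ a_{σ(l)}) a_{σ(l+1)} ⋯ a_{σ(N)}`.
The index `j` below is `l - 1`. -/
def higherAntibracket (f : A →ₗ[k] A) : OpSeq k A := fun n =>
  ∑ j : Fin (n + 1), (-1 : k) ^ (n - (j : ℕ)) •
    shuffleSum 𝒜 ((j : ℕ) + 1) (insertFirst (Nat.sub_add_cancel j.is_le)
      (mulOp (n - (j : ℕ))) (f.compMultilinearMap (mulOp (j : ℕ))))

/-- The Koszul numbers, `K_1 = 1` and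
`K_n = -2 / ((n + 2) (n - 1)) ∑_{i=1}^{n-1} S(n + 1, i) K_i` for `n ≥ 2`, with `S` the Stirling
numbers of the second kind. (The value at `0` is not used.) -/
def koszulNumber : ℕ → ℚ
  | 0 => 0
  | 1 => 1
  | n + 2 => -2 / (((n : ℚ) + 4) * ((n : ℚ) + 1)) *
      ∑ i : Fin (n + 1), (Nat.stirlingSecond (n + 3) (i + 1) : ℚ) * koszulNumber (i + 1)

/-- The adjoint operator `ρ_n = [μ_n, -]`. -/
def rho (n : ℕ) (ω : OpSeq k A) : OpSeq k A :=
  seqBracket 𝒜 (Pi.single n (mulOp n)) ω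

theorem rho_eq_zero (n : ℕ) (ω : OpSeq k A) (a : ℕ) (hω : ∀ N < a, ω N = 0) (N : ℕ)
    (hN : N < n + a) : rho 𝒜 n ω N = 0 := by
  unfold rho seqBracket
  refine Finset.sum_eq_zero fun i _ => ?_
  by_cases hi : (i : ℕ) = n
  · rw [hω (N - i) (by omega), nrBracket_zero_right]
  · rw [Pi.single_eq_of_ne (M := fun m => Op k A m) hi, nrBracket_zero_left]

/-- The operator `-∑_{n ≥ 1} K_n ρ_n` on sequences. Since `ρ_n` raises the index by `n`
(`rho_eq_zero`), only the terms with `n ≤ N` contribute to the component of index `N`. -/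
def koszulGenerator [CharZero k] (ω : OpSeq k A) : OpSeq k A := fun N =>
  -∑ n ∈ Finset.Icc 1 N, (koszulNumber n : k) • rho 𝒜 n ω N

theorem koszulGenerator_iterate_eq_zero [CharZero k] (m : ℕ) (ω : OpSeq k A) :
    ∀ N < m, ((koszulGenerator 𝒜)^[m] ω) N = 0 := by
  induction m with
  | zero => intro N hN; omega
  | succ m ih =>
    intro N hN
    rw [Function.iterate_succ_apply']
    refine neg_eq_zero.mpr (Finset.sum_eq_zero fun n hn => ?_)
    rw [Finset.mem_Icc] at hn
    rw [rho_eq_zero 𝒜 n _ m ih N (by omega), smul_zero]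

/-- The operator `exp (-∑_{n ≥ 1} K_n ρ_n)` on sequences. Since the generator raises the index
by at least one, only its powers of exponent `≤ N` contribute to the component of index `N`
(`koszulGenerator_iterate_eq_zero`). -/
def koszulExp [CharZero k] (ω : OpSeq k A) : OpSeq k A := fun N =>
  ∑ m ∈ Finset.range (N + 1), ((m.factorial : k)⁻¹) • ((koszulGenerator 𝒜)^[m] ω) N

end Algebra

end Antibracket

set_option linter.unusedSectionVars false

/-! The proof has three ingredients.

Lie structure. On lists of homogeneous elements, a sum over shuffles is a sum over unshuffles, which
is defined by recursion on the list (`sum_shuffles_eq_unshuffleSum`). All sign bookkeeping then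
reduces to coassociativity and supercocommutativity of unshuffling. The associator of `⊼` on `F, G,
H` inserts `G` and `H` into two different arguments of `F`, so it is supersymmetric in `G, H`. Thus
`⊼` is a super pre-Lie product (`seqWedge_preLie`) and its supercommutator satisfies the Jacobi
identity.

Automorphism. Put `K = ∑ K_n X^(n+1)/(n+1)!`. The generator is `-[μ_K, -]` with `μ_K = ∑ K_n μ_n`,
an even element of `D`. It is a derivation that raises the index, so its exponential converges, is
multiplicative, and is inverted by the exponential of its negative (`IsExp.bilinear`, `IsExp.neg`).

Values on linear maps. For series `P`, `Q` with exponential coefficients `p_a`, `q_b`, let `A(P, Q)`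
be the sum of all `p_a q_b` times the operators that apply `f` to a product of `a` arguments and
multiply by the other `b` arguments, summed over unshuffles. The generator sends `A(P, Q)` to `A(K
P', Q) + A(P, K Q' - K' Q)` (`koszulGeneratorHom_antiSeq`). So it acts as the vector field `K d/dX`
on the function `P` and on the coefficient `Q` of a vector field. As `f = A(X, 1)`, only two
one-variable flows are needed: `X` flows to `exp X - 1`, and `1` flows to `exp (-X)`, the reciprocal
of the derivative of `exp X - 1`. These series have exponential coefficients `1` (in positive
degree) and `(-1)^b`, so `A(exp X - 1, exp (-X))` is the sequence of antibrackets.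

The first flow is where the Koszul numbers enter. The Stirling recursion says `K'(exp X - 1) = K +
K'`, which integrates to Julia's equation `K(exp X - 1) = K exp X`. The time one flow of `K d/dX`
satisfies the same functional equation with the same second order part, and such a solution is
unique in characteristic zero (`algHom_X_unique`).

The identity for `Φ_{[f,g]}` is the automorphism applied to `[f, g]` in `D_0(A)`. If `Δ` is odd and
`Δ² = 0`, then `[Δ, Δ] = 0`, hence `[Φ_Δ, Φ_Δ] = 2 Φ_Δ ⊼ Φ_Δ = 0`. -/

namespace Antibracket

/-! ### Signs -/

section Signs

variable (k : Type*) [Ring k]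

/-- The sign `(-1)^c` of a parity `c`. -/
def paritySign (c : ZMod 2) : k := if c = 1 then -1 else 1

theorem zmod_two_cases (c : ZMod 2) : c = 0 ∨ c = 1 := by
  revert c; decide

/-- Writing the sign as a character of the product of parities turns identities between signs into
identities in `ZMod 2`. -/
theorem superSign_eq_paritySign (c d : ZMod 2) : superSign k c d = paritySign k (c * d) := by
  rcases zmod_two_cases c with rfl | rfl <;> rcases zmod_two_cases d with rfl | rfl <;>
    simp [superSign, paritySign]

theorem paritySign_mul (c d : ZMod 2) :
    paritySign k c * paritySign k d = paritySign k (c + d) := by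
  have h : (1 : ZMod 2) + 1 = 0 := by decide
  rcases zmod_two_cases c with rfl | rfl <;> rcases zmod_two_cases d with rfl | rfl <;>
    simp [paritySign, h]

@[simp] theorem paritySign_zero : paritySign k 0 = 1 := by simp [paritySign]

@[simp] theorem superSign_zero_left (c : ZMod 2) : superSign k 0 c = 1 := by simp [superSign]

@[simp] theorem superSign_zero_right (c : ZMod 2) : superSign k c 0 = 1 := by simp [superSign]

theorem superSign_comm (c d : ZMod 2) : superSign k c d = superSign k d c := by
  simp only [superSign_eq_paritySign, mul_comm]

theorem superSign_add_left (c d e : ZMod 2) :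
    superSign k (c + d) e = superSign k c e * superSign k d e := by
  simp only [superSign_eq_paritySign, paritySign_mul, add_mul]

theorem superSign_add_right (c d e : ZMod 2) :
    superSign k c (d + e) = superSign k c d * superSign k c e := by
  simp only [superSign_eq_paritySign, paritySign_mul, mul_add]

theorem superSign_mul_self (c d : ZMod 2) : superSign k c d * superSign k c d = 1 := by
  rw [superSign_eq_paritySign, paritySign_mul, CharTwo.add_self_eq_zero, paritySign_zero]

theorem superSign_smul_smul_self {M : Type*} [AddCommGroup M] [Module k M] (c d : ZMod 2)
    (m : M) : superSign k c d • superSign k c d • m = m := by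
  rw [smul_smul, superSign_mul_self, one_smul]

end Signs

/-! ### Sums over unshuffles of a list -/

section Unshuffle

/-- The parity of a list. -/
def listParity {X : Type*} (π : X → ZMod 2) (l : List X) : ZMod 2 := (l.map π).sum

section Parity

variable {X : Type*} (π : X → ZMod 2)

@[simp] theorem listParity_nil : listParity π [] = 0 := rfl

@[simp] theorem listParity_cons (x : X) (l : List X) :
    listParity π (x :: l) = π x + listParity π l := by simp [listParity]

@[simp] theorem listParity_append (l m : List X) :
    listParity π (l ++ m) = listParity π l + listParity π m := by simp [listParity]

theorem listParity_perm {l m : List X} (h : l.Perm m) : listParity π l = listParity π m :=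
  (h.map π).sum_eq

end Parity

variable {X M M' : Type*} (k : Type*) [Field k] [AddCommGroup M] [Module k M]
  [AddCommGroup M'] [Module k M'] (π : X → ZMod 2)

/-- The sum of `Ψ a b` with Koszul signs over all ways to unshuffle `l` into lists `a`, `b`. -/
def unshuffleSum : List X → (List X → List X → M) → M
  | [], Ψ => Ψ [] []
  | x :: l, Ψ => unshuffleSum l (fun a b => Ψ (x :: a) b) +
      unshuffleSum l (fun a b => superSign k (π x) (listParity π a) • Ψ a (x :: b))

theorem unshuffleSum_nil (Ψ : List X → List X → M) : unshuffleSum k π [] Ψ = Ψ [] [] := rfl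

theorem unshuffleSum_cons (x : X) (l : List X) (Ψ : List X → List X → M) :
    unshuffleSum k π (x :: l) Ψ = unshuffleSum k π l (fun a b => Ψ (x :: a) b) +
      unshuffleSum k π l (fun a b => superSign k (π x) (listParity π a) • Ψ a (x :: b)) := rfl

theorem unshuffleSum_congr {l : List X} {Ψ Ψ' : List X → List X → M}
    (h : ∀ a b, (a ++ b).Perm l → Ψ a b = Ψ' a b) :
    unshuffleSum k π l Ψ = unshuffleSum k π l Ψ' := by
  induction l generalizing Ψ Ψ' with
  | nil => exact h [] [] (by simp)
  | cons x l ih =>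
    rw [unshuffleSum_cons, unshuffleSum_cons]
    congr 1
    · exact ih fun a b hab => h _ _ (by simpa using hab)
    · refine ih fun a b hab => ?_
      rw [h a (x :: b) (List.perm_middle.trans (hab.cons x))]

theorem unshuffleSum_add (l : List X) (Ψ Ψ' : List X → List X → M) :
    unshuffleSum k π l (fun a b => Ψ a b + Ψ' a b) =
      unshuffleSum k π l Ψ + unshuffleSum k π l Ψ' := by
  induction l generalizing Ψ Ψ' with
  | nil => rfl
  | cons x l ih =>
    simp only [unshuffleSum_cons, smul_add, ih]
    abel

theorem map_unshuffleSum (g : M →ₗ[k] M') (l : List X) (Ψ : List X → List X → M) :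
    g (unshuffleSum k π l Ψ) = unshuffleSum k π l (fun a b => g (Ψ a b)) := by
  induction l generalizing Ψ with
  | nil => rfl
  | cons x l ih => simp only [unshuffleSum_cons, map_add, ih, map_smul]

theorem unshuffleSum_smul (c : k) (l : List X) (Ψ : List X → List X → M) :
    unshuffleSum k π l (fun a b => c • Ψ a b) = c • unshuffleSum k π l Ψ :=
  (map_unshuffleSum k π (LinearMap.lsmul k M c) l Ψ).symm

theorem unshuffleSum_zero (l : List X) :
    unshuffleSum k π l (fun _ _ => (0 : M)) = 0 := by
  simpa using unshuffleSum_smul k π (0 : k) l (fun _ _ => (0 : M))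

theorem unshuffleSum_sum {ι : Type*} (s : Finset ι) (l : List X)
    (Ψ : ι → List X → List X → M) :
    unshuffleSum k π l (fun a b => ∑ i ∈ s, Ψ i a b) = ∑ i ∈ s, unshuffleSum k π l (Ψ i) := by
  classical
  induction s using Finset.induction_on with
  | empty => simp [unshuffleSum_zero]
  | insert i s hi ih =>
    simp only [Finset.sum_insert hi]
    rw [unshuffleSum_add, ih]

theorem unshuffleSum_mem (N : Submodule k M) {l : List X} {Ψ : List X → List X → M}
    (h : ∀ a b, (a ++ b).Perm l → Ψ a b ∈ N) : unshuffleSum k π l Ψ ∈ N := by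
  induction l generalizing Ψ with
  | nil => exact h [] [] (by simp)
  | cons x l ih =>
    refine N.add_mem (ih fun a b hab => h _ _ (by simpa using hab)) (ih fun a b hab => ?_)
    exact N.smul_mem _ (h _ _ (List.perm_middle.trans (hab.cons x)))

/-- Coassociativity of unshuffling. -/
theorem unshuffleSum_assoc (l : List X) (Ψ : List X → List X → List X → M) :
    unshuffleSum k π l (fun a b => unshuffleSum k π a (fun a₁ a₂ => Ψ a₁ a₂ b)) =
      unshuffleSum k π l (fun a b => unshuffleSum k π b (fun b₁ b₂ => Ψ a b₁ b₂)) := by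
  induction l generalizing Ψ with
  | nil => rfl
  | cons x l ih =>
    simp only [unshuffleSum_cons, unshuffleSum_add, smul_add, add_assoc]
    congr 1
    · exact ih _
    · congr 1
      · simp only [← unshuffleSum_smul]
        exact ih fun a b c => superSign k (π x) (listParity π a) • Ψ a (x :: b) c
      -- Here `x` lands in the third block; its sign for passing `a` factors over the two parts into
      -- which `a` is then split.
      · have h : ∀ a b : List X, (a ++ b).Perm l →
            superSign k (π x) (listParity π a) •
              unshuffleSum k π a (fun a₁ a₂ => Ψ a₁ a₂ (x :: b)) =
            unshuffleSum k π a (fun a₁ a₂ => (superSign k (π x) (listParity π a₁) *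
              superSign k (π x) (listParity π a₂)) • Ψ a₁ a₂ (x :: b)) := by
          intro a b _
          rw [← unshuffleSum_smul]
          refine unshuffleSum_congr k π fun a₁ a₂ h => ?_
          rw [← superSign_add_right, ← listParity_append, listParity_perm π h]
        rw [unshuffleSum_congr k π h, ih fun a b c => (superSign k (π x) (listParity π a) *
              superSign k (π x) (listParity π b)) • Ψ a b (x :: c)]
        simp only [mul_smul, unshuffleSum_smul]

/-- Supercocommutativity of unshuffling. -/
theorem unshuffleSum_comm (l : List X) (Ψ : List X → List X → M) :
    unshuffleSum k π l Ψ = unshuffleSum k π l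
      (fun a b => superSign k (listParity π a) (listParity π b) • Ψ b a) := by
  induction l generalizing Ψ with
  | nil => simp [unshuffleSum_nil]
  | cons x l ih =>
    -- Exchanging the blocks exchanges the two terms of the recursion, since `x` moves from one
    -- block to the other.
    rw [unshuffleSum_cons, unshuffleSum_cons, add_comm, ih, ih fun a b => Ψ (x :: a) b]
    congr 1
    · refine unshuffleSum_congr k π fun a b _ => ?_
      rw [smul_smul, listParity_cons, superSign_add_left, mul_comm]
    · refine unshuffleSum_congr k π fun a b _ => ?_
      rw [smul_smul, listParity_cons, superSign_add_right, superSign_comm k (π x), ← mul_assoc,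
        superSign_mul_self, one_mul]

/-- A function of lists is supersymmetric if exchanging two adjacent entries produces the
Koszul sign. -/
def ListSupersymmetric (Ψ : List X → M) : Prop :=
  ∀ (l : List X) (x y : X) (m : List X),
    Ψ (l ++ x :: y :: m) = superSign k (π x) (π y) • Ψ (l ++ y :: x :: m)

theorem ListSupersymmetric.cons {Ψ : List X → M} (h : ListSupersymmetric k π Ψ) (z : X) :
    ListSupersymmetric k π (fun l => Ψ (z :: l)) :=
  fun l x y m => h (z :: l) x y m

/-- An earlier entry sent to the second block contributes a sign that depends on the first block
only through its parity, and a transposition does not change that parity. -/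
theorem ListSupersymmetric.parity_smul {Ψ : List X → M} (h : ListSupersymmetric k π Ψ)
    (c : ZMod 2) :
    ListSupersymmetric k π (fun l => superSign k c (listParity π l) • Ψ l) := by
  intro l x y m
  have h1 : listParity π (l ++ x :: y :: m) = listParity π (l ++ y :: x :: m) := by
    simp only [listParity_append, listParity_cons]
    ring
  simp only [h l x y m, h1]
  rw [smul_comm]

/-- If `x` and `y` land in the same block, supersymmetry of `Ψ` in that block gives the sign; if
they land in different blocks, the Koszul signs of the two unshuffles differ by exactly that sign.
-/
theorem unshuffleSum_swap (l : List X) (x y : X) (m : List X) (Ψ : List X → List X → M)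
    (h1 : ∀ b, ListSupersymmetric k π (fun a => Ψ a b))
    (h2 : ∀ a, ListSupersymmetric k π (fun b => Ψ a b)) :
    unshuffleSum k π (l ++ x :: y :: m) Ψ =
      superSign k (π x) (π y) • unshuffleSum k π (l ++ y :: x :: m) Ψ := by
  induction l generalizing Ψ with
  | nil =>
    simp only [List.nil_append, unshuffleSum_cons, smul_add, listParity_cons]
    -- The four terms are indexed by the blocks of `x` and `y`; this exchanges the two mixed ones so
    -- that both sides match term by term.
    conv_rhs => rw [add_add_add_comm]
    simp only [← unshuffleSum_smul]
    congr 1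
    · congr 1
      · exact unshuffleSum_congr k π fun a b _ => h1 b [] x y a
      · refine unshuffleSum_congr k π fun a b _ => ?_
        rw [superSign_add_right, superSign_comm k (π y) (π x), mul_smul,
          superSign_smul_smul_self]
    · congr 1
      · refine unshuffleSum_congr k π fun a b _ => ?_
        rw [superSign_add_right, mul_smul]
      · refine unshuffleSum_congr k π fun a b _ => ?_
        have h := h2 a [] x y b
        simp only [List.nil_append] at h
        rw [h]
        simp only [smul_smul]
        congr 1
        ring
  | cons z l ih =>
    simp only [List.cons_append, unshuffleSum_cons, smul_add]
    congr 1
    · exact ih _ (fun b => (h1 b).cons k π z) (fun a => h2 (z :: a))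
    · refine ih _ (fun b => (h1 (z :: b)).parity_smul k π (π z)) (fun a => ?_)
      intro l x y m
      have := h2 a (z :: l) x y m
      simp only [List.cons_append] at this
      simp only [this]
      rw [smul_comm]

theorem listSupersymmetric_unshuffleSum (Ψ : List X → List X → M)
    (h1 : ∀ b, ListSupersymmetric k π (fun a => Ψ a b))
    (h2 : ∀ a, ListSupersymmetric k π (fun b => Ψ a b)) :
    ListSupersymmetric k π (fun l => unshuffleSum k π l Ψ) :=
  fun l x y m => unshuffleSum_swap k π l x y m Ψ h1 h2

end Unshuffle

end Antibracket

namespace Antibracket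

/-! ### Shuffle permutations and unshuffles of lists -/

section Shuffles

/-- The permutation of `Fin (N + 1)` that sends `q` to `0` and is given by `τ` elsewhere. -/
def insPerm {N : ℕ} (q : Fin (N + 1)) (τ : Equiv.Perm (Fin N)) : Equiv.Perm (Fin (N + 1)) :=
  (finSuccEquiv' q).trans ((Equiv.optionCongr τ).trans (finSuccEquiv' 0).symm)

@[simp] theorem insPerm_self {N : ℕ} (q : Fin (N + 1)) (τ : Equiv.Perm (Fin N)) :
    insPerm q τ q = 0 := by
  simp [insPerm]

@[simp] theorem insPerm_succAbove {N : ℕ} (q : Fin (N + 1)) (τ : Equiv.Perm (Fin N))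
    (i : Fin N) : insPerm q τ (q.succAbove i) = (τ i).succ := by
  simp [insPerm]

theorem insPerm_bijective (N : ℕ) : Function.Bijective
    (fun x : Fin (N + 1) × Equiv.Perm (Fin N) => insPerm x.1 x.2) := by
  rw [Fintype.bijective_iff_injective_and_card]
  constructor
  · rintro ⟨q, τ⟩ ⟨q', τ'⟩ h
    simp only at h
    have hq : q = q' := (insPerm q' τ').injective (by rw [← h, insPerm_self, h, insPerm_self])
    subst hq
    congr 1
    ext i
    have := congrArg (fun σ => σ (q.succAbove i)) h
    simpa [Fin.ext_iff] using this
  · simp [Fintype.card_perm, Nat.factorial_succ]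

theorem sum_perm_succ {M : Type*} [AddCommMonoid M] {N : ℕ}
    (f : Equiv.Perm (Fin (N + 1)) → M) :
    ∑ σ, f σ = ∑ q : Fin (N + 1), ∑ τ : Equiv.Perm (Fin N), f (insPerm q τ) := by
  rw [← Fintype.sum_prod_type', ← (insPerm_bijective N).sum_comp f]

theorem mem_shuffles {a N : ℕ} {σ : Equiv.Perm (Fin N)} : σ ∈ shuffles a N ↔
    (∀ x y : Fin N, x < y → (y : ℕ) < a → σ x < σ y) ∧
    (∀ x y : Fin N, x < y → a ≤ (x : ℕ) → σ x < σ y) := by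
  simp [shuffles]

theorem val_succAbove {N : ℕ} (q : Fin (N + 1)) (i : Fin N) :
    (q.succAbove i : ℕ) = if (i : ℕ) < q then (i : ℕ) else i + 1 := by
  by_cases h : (i : ℕ) < q
  · rw [Fin.succAbove_of_castSucc_lt _ _ (by simpa [Fin.lt_def] using h)]
    simp [h]
  · rw [Fin.succAbove_of_le_castSucc _ _ (by simpa [Fin.le_def] using h)]
    simp [h]

/-- The smallest value of a shuffle must stand first in one of the two increasing runs, so at
position `0` or `a`. The condition `0 < a` keeps the two alternatives disjoint. They become the two
terms in the recursion of `unshuffleSum`. -/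
theorem insPerm_mem_shuffles_iff {a N : ℕ} (q : Fin (N + 1)) (τ : Equiv.Perm (Fin N)) :
    insPerm q τ ∈ shuffles a (N + 1) ↔
      ((q : ℕ) = 0 ∧ 0 < a ∧ τ ∈ shuffles (a - 1) N) ∨ ((q : ℕ) = a ∧ τ ∈ shuffles a N) := by
  simp only [mem_shuffles]
  constructor
  · rintro ⟨h1, h2⟩
    have key : ∀ x y : Fin N, ((q.succAbove y : ℕ) < a ∨ a ≤ (q.succAbove x : ℕ)) →
        x < y → τ x < τ y := by
      intro x y h hxy
      have hlt : q.succAbove x < q.succAbove y := (Fin.strictMono_succAbove q) hxy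
      rcases h with h | h
      · simpa using h1 _ _ hlt h
      · simpa using h2 _ _ hlt h
    have hq : (q : ℕ) = 0 ∨ (q : ℕ) = a := by
      by_contra! hq
      rcases lt_or_ge (q : ℕ) a with h | h
      · have := h1 0 q (by simp only [Fin.lt_def, Fin.val_zero]; omega) h
        simp at this
      · have := h2 ⟨a, by omega⟩ q (by simp only [Fin.lt_def]; omega) le_rfl
        simp at this
    rcases Nat.eq_zero_or_pos a with ha | ha
    · refine Or.inr ⟨by omega, ?_, ?_⟩
      · intro x y _ hy
        omega
      · intro x y hxy _
        exact key x y (Or.inr (by omega)) hxy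
    · rcases hq with hq | hq
      · refine Or.inl ⟨hq, ha, ?_, ?_⟩
        · intro x y hxy hy
          refine key x y (Or.inl ?_) hxy
          rw [val_succAbove]; split_ifs <;> omega
        · intro x y hxy hx
          refine key x y (Or.inr ?_) hxy
          rw [val_succAbove]; split_ifs <;> omega
      · refine Or.inr ⟨hq, ?_, ?_⟩
        · intro x y hxy hy
          refine key x y (Or.inl ?_) hxy
          rw [val_succAbove]; split_ifs <;> omega
        · intro x y hxy hx
          refine key x y (Or.inr ?_) hxy
          rw [val_succAbove]; split_ifs <;> omega
  · intro h
    have key : ∀ x y : Fin (N + 1), x < y → ((y : ℕ) < a ∨ a ≤ (x : ℕ)) →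
        insPerm q τ x < insPerm q τ y := by
      intro x y hxy hc
      rcases eq_or_ne x q with rfl | hx
      · obtain ⟨j, rfl⟩ := Fin.exists_succAbove_eq hxy.ne'
        simp
      · obtain ⟨i, rfl⟩ := Fin.exists_succAbove_eq hx
        rcases eq_or_ne y q with rfl | hy
        · rw [Fin.lt_def] at hxy
          rcases h with h | h <;> omega
        · obtain ⟨j, rfl⟩ := Fin.exists_succAbove_eq hy
          have hij : i < j := (Fin.strictMono_succAbove q).lt_iff_lt.mp hxy
          simp only [insPerm_succAbove, Fin.succ_lt_succ_iff]
          rw [val_succAbove, val_succAbove] at hc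
          rcases h with ⟨hq, ha, h1, h2⟩ | ⟨hq, h1, h2⟩
          · rcases hc with hc | hc
            · exact h1 i j hij (by split_ifs at hc <;> omega)
            · exact h2 i j hij (by split_ifs at hc <;> omega)
          · rcases hc with hc | hc
            · exact h1 i j hij (by split_ifs at hc <;> omega)
            · exact h2 i j hij (by split_ifs at hc <;> omega)
    exact ⟨fun x y hxy hy => key x y hxy (Or.inl hy), fun x y hxy hx => key x y hxy (Or.inr hx)⟩

theorem ite_or_of_disjoint {M : Type*} [AddMonoid M] {P Q : Prop} [Decidable P] [Decidable Q]
    (x : M) (h : ¬(P ∧ Q)) :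
    (if P ∨ Q then x else 0) = (if P then x else 0) + (if Q then x else 0) := by
  by_cases hP : P
  · have hQ : ¬Q := fun hQ => h ⟨hP, hQ⟩
    simp [hP, hQ]
  · simp [hP]

theorem sum_shuffles_succ {M : Type*} [AddCommMonoid M] {a N : ℕ} (ha : a ≤ N + 1)
    (f : Equiv.Perm (Fin (N + 1)) → M) :
    ∑ σ ∈ shuffles a (N + 1), f σ =
      (if 0 < a then ∑ τ ∈ shuffles (a - 1) N, f (insPerm 0 τ) else 0) +
      (if h : a < N + 1 then ∑ τ ∈ shuffles a N, f (insPerm ⟨a, h⟩ τ) else 0) := by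
  classical
  have h1 : ∀ (b n : ℕ) (g : Equiv.Perm (Fin n) → M),
      ∑ σ ∈ shuffles b n, g σ = ∑ σ, if σ ∈ shuffles b n then g σ else 0 := by
    intro b n g
    rw [← Finset.sum_filter]
    simp
  rw [h1, sum_perm_succ]
  simp only [insPerm_mem_shuffles_iff]
  have h2 : ∀ (q : Fin (N + 1)) (τ : Equiv.Perm (Fin N)),
      (if ((q : ℕ) = 0 ∧ 0 < a ∧ τ ∈ shuffles (a - 1) N) ∨ ((q : ℕ) = a ∧ τ ∈ shuffles a N)
        then f (insPerm q τ) else 0) =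
      (if (q : ℕ) = 0 then
        (if 0 < a then if τ ∈ shuffles (a - 1) N then f (insPerm q τ) else 0 else 0) else 0) +
      (if (q : ℕ) = a then if τ ∈ shuffles a N then f (insPerm q τ) else 0 else 0) := by
    intro q τ
    rw [ite_or_of_disjoint _ (by rintro ⟨⟨h, h', _⟩, h'', _⟩; omega), ite_and, ite_and, ite_and]
  simp only [h2, Finset.sum_add_distrib]
  congr 1
  · rw [Finset.sum_eq_single 0]
    · rw [h1]
      simp
    · intro q _ hq
      have : (q : ℕ) ≠ 0 := fun h => hq (Fin.ext h)
      simp [this]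
    · simp
  · split_ifs with h
    · rw [Finset.sum_eq_single ⟨a, h⟩]
      · rw [h1]
        simp
      · intro q _ hq
        have : (q : ℕ) ≠ a := fun h => hq (Fin.ext h)
        simp [this]
      · simp
    · refine Finset.sum_eq_zero fun q _ => Finset.sum_eq_zero fun τ _ => ?_
      rw [if_neg (by omega)]

variable (k : Type*) [Field k]

theorem koszulSign_eq_prod {N : ℕ} (σ : Equiv.Perm (Fin N)) (p : Fin N → ZMod 2) :
    koszulSign k σ p = ∏ x, ∏ y,
      if x < y ∧ σ y < σ x then superSign k (p (σ x)) (p (σ y)) else 1 := by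
  rw [koszulSign, ← Finset.prod_const, Finset.prod_filter, ← Finset.univ_product_univ,
    Finset.prod_product]
  refine Finset.prod_congr rfl fun x _ => Finset.prod_congr rfl fun y _ => ?_
  simp only [superSign]
  split_ifs <;> tauto

theorem prod_superSign {ι : Type*} (s : Finset ι) (c : ZMod 2) (f : ι → ZMod 2) :
    ∏ i ∈ s, superSign k c (f i) = superSign k c (∑ i ∈ s, f i) := by
  classical
  induction s using Finset.induction_on with
  | empty => simp
  | insert i s hi ih => rw [Finset.prod_insert hi, Finset.sum_insert hi, ih, superSign_add_right]

/-- The argument numbered `0` is inverted exactly with the arguments placed before it, at positions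
below `q`; all other inversions are those of `τ`. -/
theorem koszulSign_insPerm {N : ℕ} (q : Fin (N + 1)) (τ : Equiv.Perm (Fin N))
    (p : Fin (N + 1) → ZMod 2) :
    koszulSign k (insPerm q τ) p =
      superSign k (p 0) (∑ i : Fin N, if (i : ℕ) < q then p (τ i).succ else 0) *
        koszulSign k τ (fun i => p i.succ) := by
  rw [koszulSign_eq_prod, koszulSign_eq_prod, Fin.prod_univ_succAbove _ q]
  simp only [Fin.prod_univ_succAbove _ q, insPerm_self, insPerm_succAbove]
  rw [Finset.prod_mul_distrib]
  simp only [lt_irrefl, Fin.not_lt_zero, and_false, if_false, Finset.prod_const_one, mul_one,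
    Fin.succ_pos, and_true, one_mul, (Fin.strictMono_succAbove q).lt_iff_lt,
    Fin.succ_lt_succ_iff]
  congr 1
  rw [← prod_superSign]
  refine Finset.prod_congr rfl fun i _ => ?_
  rw [superSign_comm]
  simp only [Fin.lt_def, val_succAbove]
  by_cases h : (i : ℕ) < q
  · simp [h]
  · have : ¬ ((i : ℕ) + 1 < q) := by omega
    simp [h, this]

theorem listParity_take_ofFn {X : Type*} (π : X → ZMod 2) {N : ℕ} (g : Fin N → X) (a : ℕ) :
    listParity π ((List.ofFn g).take a) = ∑ i : Fin N, if (i : ℕ) < a then π (g i) else 0 := by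
  induction N generalizing a with
  | zero => simp
  | succ N ih =>
    cases a with
    | zero => simp
    | succ a => simp [List.ofFn_succ, Fin.sum_univ_succ, ih]

theorem ofFn_comp_insPerm_zero {X : Type*} {N : ℕ} (w : Fin (N + 1) → X)
    (τ : Equiv.Perm (Fin N)) :
    List.ofFn (fun i => w (insPerm 0 τ i)) = w 0 :: List.ofFn (fun i => w (τ i).succ) := by
  rw [List.ofFn_succ, insPerm_self]
  congr 2

theorem ofFn_comp_insPerm {X : Type*} {N : ℕ} (w : Fin (N + 1) → X) (q : Fin (N + 1))
    (τ : Equiv.Perm (Fin N)) :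
    (List.ofFn (fun i => w (insPerm q τ i))).take q =
        (List.ofFn (fun i => w (τ i).succ)).take q ∧
      (List.ofFn (fun i => w (insPerm q τ i))).drop q =
        w 0 :: (List.ofFn (fun i => w (τ i).succ)).drop q := by
  have hq := q.is_lt
  constructor
  · refine List.ext_getElem (by simp; omega) fun i h1 h2 => ?_
    simp only [List.length_take, List.length_ofFn, lt_min_iff] at h1 h2
    simp only [List.getElem_take, List.getElem_ofFn]
    rw [← insPerm_succAbove q τ ⟨i, h2.2⟩]
    congr 2
    ext
    simp [val_succAbove, h1.1]
  · refine List.ext_getElem (by simp; omega) fun i h1 h2 => ?_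
    simp only [List.length_drop, List.length_ofFn] at h1
    cases i with
    | zero => simp only [List.getElem_drop, List.getElem_ofFn, Nat.add_zero, Fin.eta, insPerm_self,
        List.getElem_cons_zero]
    | succ i =>
      simp only [List.getElem_drop, List.getElem_ofFn, List.getElem_cons_succ]
      rw [← insPerm_succAbove q τ ⟨q + i, by omega⟩]
      congr 2
      ext
      simp [val_succAbove]
      omega

/-- Sums over shuffle permutations with Koszul signs are sums over unshuffles of lists. -/
theorem sum_shuffles_eq_unshuffleSum {X M : Type*} [AddCommGroup M] [Module k M]
    (π : X → ZMod 2) {N : ℕ} (w : Fin N → X) (a : ℕ) (ha : a ≤ N) (Ψ : List X → List X → M) :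
    ∑ σ ∈ shuffles a N, koszulSign k σ (fun i => π (w i)) •
        Ψ ((List.ofFn fun i => w (σ i)).take a) ((List.ofFn fun i => w (σ i)).drop a) =
      unshuffleSum k π (List.ofFn w) (fun u v => if u.length = a then Ψ u v else 0) := by
  induction N generalizing a Ψ with
  | zero =>
    obtain rfl : a = 0 := by omega
    have h : shuffles 0 0 = Finset.univ := by
      ext σ
      simpa [mem_shuffles] using Subsingleton.elim _ _
    simp [h, koszulSign, unshuffleSum_nil]
  | succ N ih =>
    rw [sum_shuffles_succ ha, List.ofFn_succ, unshuffleSum_cons]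
    congr 1
    · cases a with
      | zero => simp [unshuffleSum_zero]
      | succ a =>
        simp only [Nat.succ_pos, if_true, Nat.add_sub_cancel, ofFn_comp_insPerm_zero,
          List.take_succ_cons, List.drop_succ_cons, koszulSign_insPerm, Fin.val_zero,
          Nat.not_lt_zero, if_false, Finset.sum_const_zero, superSign_zero_right, one_mul,
          List.length_cons, Nat.add_right_cancel_iff]
        exact ih (fun i => w i.succ) a (by omega) (fun u v => Ψ (w 0 :: u) v)
    · split_ifs with h
      · have := ih (fun i => w i.succ) a (by omega)
          (fun u v => superSign k (π (w 0)) (listParity π u) • Ψ u (w 0 :: v))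
        simp only [smul_ite, smul_zero]
        rw [← this]
        refine Finset.sum_congr rfl fun τ _ => ?_
        have h2 := ofFn_comp_insPerm w ⟨a, h⟩ τ
        simp only at h2
        rw [h2.1, h2.2, koszulSign_insPerm, listParity_take_ofFn, mul_comm, mul_smul]
      -- Here `a = N + 1`: the first block is the whole list, so no unshuffle of the right size
      -- sends the head to the second block.
      · refine (unshuffleSum_zero k π (List.ofFn fun i => w i.succ)).symm.trans ?_
        refine unshuffleSum_congr k π fun u v huv => ?_
        have := huv.length_eq
        simp only [List.length_append, List.length_ofFn] at this
        rw [if_neg (by omega), smul_zero]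

end Shuffles

end Antibracket

namespace Antibracket

/-! ### Evaluation of operators on lists -/

section Evaluation

variable {k A : Type*} [Field k] [AddCommGroup A] [Module k A]

/-- The value of an operator on a list of the right length, and zero on other lists. -/
def evOp {n : ℕ} (l : List A) : Op k A n →ₗ[k] A where
  toFun F := if h : l.length = n + 1 then F (fun i => l.get (i.cast h.symm)) else 0
  map_add' F G := by split_ifs <;> simp
  map_smul' c F := by split_ifs <;> simp

theorem evOp_apply {n : ℕ} (l : List A) (F : Op k A n) :
    evOp l F = if h : l.length = n + 1 then F (fun i => l.get (i.cast h.symm)) else 0 := rfl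

theorem evOp_of_length_ne {n : ℕ} {l : List A} (h : l.length ≠ n + 1) (F : Op k A n) :
    evOp l F = 0 := by
  rw [evOp_apply, dif_neg h]

theorem evOp_ofFn {n : ℕ} (v : Fin (n + 1) → A) (F : Op k A n) :
    evOp (List.ofFn v) F = F v := by
  rw [evOp_apply, dif_pos (by simp)]
  congr 1
  funext i
  simp [-List.ofFn_succ]

theorem evOp_cons {n : ℕ} (a : A) (v : Fin n → A) (F : Op k A n) :
    evOp (a :: List.ofFn v) F = F (Fin.cons a v) := by
  rw [← evOp_ofFn, List.ofFn_succ]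
  simp

/-- The value of an operator as a linear function of its first argument. -/
def headOp {n : ℕ} (F : Op k A n) (t : List A) : A →ₗ[k] A where
  toFun a := evOp (a :: t) F
  map_add' a b := by
    by_cases h : t.length = n
    · obtain ⟨v, rfl⟩ : ∃ v : Fin n → A, t = List.ofFn v := by
        subst h
        exact ⟨t.get, (List.ofFn_get t).symm⟩
      simp only [evOp_cons, MultilinearMap.cons_add]
    · simp [evOp_of_length_ne (l := _ :: t) (by simpa using h)]
  map_smul' c a := by
    by_cases h : t.length = n
    · obtain ⟨v, rfl⟩ : ∃ v : Fin n → A, t = List.ofFn v := by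
        subst h
        exact ⟨t.get, (List.ofFn_get t).symm⟩
      simp only [evOp_cons, MultilinearMap.cons_smul, RingHom.id_apply]
    · simp [evOp_of_length_ne (l := _ :: t) (by simpa using h)]

theorem headOp_apply {n : ℕ} (F : Op k A n) (t : List A) (a : A) :
    headOp F t a = evOp (a :: t) F := rfl

/-- The value of a sequence of operators on a list. -/
def ev (l : List A) : OpSeq k A →ₗ[k] A :=
  evOp l ∘ₗ LinearMap.proj (l.length - 1)

theorem ev_eq_evOp {n : ℕ} {l : List A} (h : l.length = n + 1) (F : OpSeq k A) :
    ev l F = evOp l (F n) := by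
  obtain rfl : n = l.length - 1 := by omega
  rfl

theorem evOp_eq_ite {n : ℕ} (l : List A) (F : OpSeq k A) :
    evOp l (F n) = if l.length = n + 1 then ev l F else 0 := by
  split_ifs with h
  · rw [ev_eq_evOp h]
  · rw [evOp_of_length_ne h]

@[simp] theorem ev_nil (F : OpSeq k A) : ev [] F = 0 :=
  evOp_of_length_ne (l := []) (by simp) (F 0)

/-- The value of a sequence of operators as a linear function of the first argument. -/
def head (F : OpSeq k A) (t : List A) : A →ₗ[k] A := headOp (F t.length) t

theorem head_apply (F : OpSeq k A) (t : List A) (a : A) : head F t a = ev (a :: t) F := rfl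

end Evaluation

/-! ### Operators tested on lists of homogeneous elements -/

section Homogeneous

variable {k A : Type*} [Field k] [AddCommGroup A] [Module k A]
  (𝒜 : ZMod 2 → Submodule k A)

/-- Homogeneous elements together with their parities. -/
abbrev HomElt : Type _ := Σ c : ZMod 2, 𝒜 c

variable {𝒜}

/-- The underlying list of elements of a list of homogeneous elements. -/
def raw (l : List (HomElt 𝒜)) : List A := l.map fun x => (x.2 : A)

@[simp] theorem raw_nil : raw ([] : List (HomElt 𝒜)) = [] := rfl

@[simp] theorem raw_cons (x : HomElt 𝒜) (l : List (HomElt 𝒜)) :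
    raw (x :: l) = (x.2 : A) :: raw l := rfl

@[simp] theorem raw_append (l m : List (HomElt 𝒜)) : raw (l ++ m) = raw l ++ raw m := by
  simp [raw]

@[simp] theorem length_raw (l : List (HomElt 𝒜)) : (raw l).length = l.length := by simp [raw]

theorem raw_ofFn {n : ℕ} (w : Fin n → HomElt 𝒜) :
    raw (List.ofFn w) = List.ofFn fun i => ((w i).2 : A) := by
  rw [raw, List.map_ofFn]
  rfl

theorem exists_eq_ofFn {X : Type*} {n : ℕ} {l : List X} (h : l.length = n) :
    ∃ w : Fin n → X, l = List.ofFn w := by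
  subst h
  exact ⟨l.get, (List.ofFn_get l).symm⟩

variable (𝒜)

/-- The sum over unshuffles of a list of homogeneous elements. -/
abbrev unsh {M : Type*} [AddCommGroup M] [Module k M] (l : List (HomElt 𝒜))
    (Ψ : List (HomElt 𝒜) → List (HomElt 𝒜) → M) : M :=
  unshuffleSum k Sigma.fst l Ψ

variable {𝒜}

/-- The parity of a list of homogeneous elements. -/
abbrev pr (l : List (HomElt 𝒜)) : ZMod 2 := listParity Sigma.fst l

theorem pr_ofFn {n : ℕ} (w : Fin n → HomElt 𝒜) :
    pr (List.ofFn w) = ∑ i, (w i).1 := by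
  simp [pr, listParity, List.map_ofFn, List.sum_ofFn]

theorem mem_opOfParity_iff {d : ZMod 2} {n : ℕ} {F : Op k A n} :
    F ∈ opOfParity 𝒜 d n ↔ ∀ l : List (HomElt 𝒜), evOp (raw l) F ∈ 𝒜 (d + pr l) := by
  constructor
  · intro h l
    by_cases hl : l.length = n + 1
    · obtain ⟨w, rfl⟩ := exists_eq_ofFn hl
      rw [raw_ofFn, evOp_ofFn, pr_ofFn]
      exact h _ _ fun i => (w i).2.2
    · rw [evOp_of_length_ne (by simpa using hl)]
      exact Submodule.zero_mem _
  · intro h p v hv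
    have := h (List.ofFn fun i => ⟨p i, v i, hv i⟩)
    rwa [raw_ofFn, evOp_ofFn, pr_ofFn] at this

theorem mem_D_apply {ω : OpSeq k A} : ω ∈ D 𝒜 ↔ ∀ n, ω n ∈ supersymmetric 𝒜 n := by
  simp [D, Submodule.mem_pi]

theorem mem_seqOfParity_apply {c : ZMod 2} {ω : OpSeq k A} :
    ω ∈ seqOfParity 𝒜 c ↔ ∀ n, ω n ∈ opOfParity 𝒜 c n := by
  simp [seqOfParity, Submodule.mem_pi]

theorem mem_seqOfParity_iff {d : ZMod 2} {F : OpSeq k A} :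
    F ∈ seqOfParity 𝒜 d ↔ ∀ l : List (HomElt 𝒜), ev (raw l) F ∈ 𝒜 (d + pr l) := by
  simp only [seqOfParity, Submodule.mem_pi, Set.mem_univ, true_implies, mem_opOfParity_iff]
  constructor
  · intro h l
    exact h _ l
  · intro h n l
    rw [evOp_eq_ite]
    split_ifs
    · exact h l
    · exact Submodule.zero_mem _

/-- Exchanging the entries `l.length` and `l.length + 1`. -/
theorem get_swap {X : Type*} (l : List X) (x y : X) (m : List X) (i : ℕ)
    (hi : i < (l ++ y :: x :: m).length) :
    (l ++ y :: x :: m)[i] = if i = l.length then y else if i = l.length + 1 then x else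
      (l ++ x :: y :: m)[i]'(by simpa using hi) := by
  simp only [List.getElem_append]
  split_ifs with h1 h2 h3 h2 h3
  · omega
  · omega
  · rfl
  · simp [h2]
  · simp [h3]
  · obtain ⟨j, rfl⟩ : ∃ j, i = l.length + 2 + j := ⟨i - (l.length + 2), by omega⟩
    have : l.length + 2 + j - l.length = j + 1 + 1 := by omega
    simp [this]

theorem mem_supersymmetric_iff {n : ℕ} {F : Op k A n} :
    F ∈ supersymmetric 𝒜 n ↔
      ListSupersymmetric k Sigma.fst (fun l : List (HomElt 𝒜) => evOp (raw l) F) := by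
  constructor
  · intro h l x y m
    simp only
    by_cases hl : (l ++ x :: y :: m).length = n + 1
    · have hl' : (l ++ y :: x :: m).length = n + 1 := by simpa using hl
      obtain ⟨w, hw⟩ := exists_eq_ofFn hl
      obtain ⟨w', hw'⟩ := exists_eq_ofFn hl'
      have hlen : l.length + 1 < n + 1 := by
        simp only [List.length_append, List.length_cons] at hl
        omega
      have e1 : ∀ i : Fin (n + 1), w i = (l ++ x :: y :: m)[(i : ℕ)]'(by rw [hl]; exact i.2) := by
        intro i
        simp [hw, -List.ofFn_succ]
      have e2 : ∀ i : Fin (n + 1), w' i = (l ++ y :: x :: m)[(i : ℕ)]'(by rw [hl']; exact i.2) := by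
        intro i
        simp [hw', -List.ofFn_succ]
      have h1 : w ⟨l.length, by omega⟩ = x := by simp [e1]
      have h2 : w ⟨l.length + 1, hlen⟩ = y := by simp [e1]
      have h3 : w' = fun i => w (Equiv.swap ⟨l.length, by omega⟩ ⟨l.length + 1, hlen⟩ i) := by
        funext i
        rw [e2, get_swap, Equiv.swap_apply_def]
        simp only [Fin.ext_iff]
        split_ifs
        · exact h2.symm
        · exact h1.symm
        · rw [e1]
      have key := h (fun i => (w i).1) (fun i => (w i).2) (fun i => (w i).2.2)
        ⟨l.length, by omega⟩ ⟨l.length + 1, hlen⟩ rfl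
      rw [hw, hw', raw_ofFn, raw_ofFn, evOp_ofFn, evOp_ofFn, key, h3, h1, h2]
    · rw [evOp_of_length_ne (by simpa using hl), evOp_of_length_ne (by simpa using hl), smul_zero]
  · intro h p v hv i j hij
    set w : Fin (n + 1) → HomElt 𝒜 := fun i => ⟨p i, v i, hv i⟩ with hw
    have hj := j.2
    have hwl : (List.ofFn w).length = n + 1 := List.length_ofFn
    have e1 : List.ofFn w = (List.ofFn w).take i ++ w i :: w j :: (List.ofFn w).drop (i + 2) := by
      conv_lhs => rw [← List.take_append_drop i (List.ofFn w)]
      congr 1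
      rw [List.drop_eq_getElem_cons (by omega), List.drop_eq_getElem_cons (by omega)]
      simp [← hij, -List.ofFn_succ]
      omega
    have e2 : List.ofFn (fun l => w (Equiv.swap i j l)) =
        (List.ofFn w).take i ++ w j :: w i :: (List.ofFn w).drop (i + 2) := by
      refine List.ext_getElem (by simp; omega) fun l h1 h2 => ?_
      rw [get_swap]
      have hl : ((List.ofFn w).take i).length = i := by simp
      simp only [← e1, hl, List.getElem_ofFn, Equiv.swap_apply_def, Fin.ext_iff, ← hij]
      split_ifs <;> rfl
    have key := h ((List.ofFn w).take i) (w i) (w j) ((List.ofFn w).drop (i + 2))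
    simp only [← e1, ← e2, raw_ofFn, evOp_ofFn] at key
    exact key

theorem mem_D_iff {F : OpSeq k A} :
    F ∈ D 𝒜 ↔ ListSupersymmetric k Sigma.fst (fun l : List (HomElt 𝒜) => ev (raw l) F) := by
  simp only [D, Submodule.mem_pi, Set.mem_univ, true_implies, mem_supersymmetric_iff]
  constructor
  · intro h l x y m
    simp only
    have h1 : (raw (l ++ x :: y :: m)).length = (l.length + m.length + 1) + 1 := by simp; omega
    have h2 : (raw (l ++ y :: x :: m)).length = (l.length + m.length + 1) + 1 := by simp; omega
    rw [ev_eq_evOp h1, ev_eq_evOp h2]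
    exact h _ l x y m
  · intro h n l x y m
    simp only [evOp_eq_ite, h l x y m, length_raw, List.length_append, List.length_cons, smul_ite,
      smul_zero]

variable (𝒜) [DirectSum.Decomposition 𝒜]

theorem sum_parityProj (a : A) : ∑ c : ZMod 2, parityProj 𝒜 c a = a := by
  have h : ∀ c, parityProj 𝒜 c a = (DirectSum.decompose 𝒜 a c : A) := fun c => rfl
  simp only [h]
  classical
  conv_rhs => rw [← DirectSum.sum_support_decompose 𝒜 a]
  symm
  refine Finset.sum_subset (Finset.subset_univ _) fun c _ hc => ?_
  simpa using hc

theorem parityProj_mem (c : ZMod 2) (a : A) : parityProj 𝒜 c a ∈ 𝒜 c :=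
  (DirectSum.decompose 𝒜 a c).2

/-- Every argument is the sum of its homogeneous components, so multilinearity reduces equality to
homogeneous lists. -/
theorem op_ext {n : ℕ} {F G : Op k A n}
    (h : ∀ l : List (HomElt 𝒜), evOp (raw l) F = evOp (raw l) G) : F = G := by
  ext v
  have hv : v = fun i => ∑ c : ZMod 2, parityProj 𝒜 c (v i) := by
    funext i
    rw [sum_parityProj]
  rw [hv, MultilinearMap.map_sum, MultilinearMap.map_sum]
  refine Finset.sum_congr rfl fun p _ => ?_
  have := h (List.ofFn fun i => ⟨p i, _, parityProj_mem 𝒜 (p i) (v i)⟩)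
  rwa [raw_ofFn, evOp_ofFn, evOp_ofFn] at this

theorem seq_ext {F G : OpSeq k A}
    (h : ∀ l : List (HomElt 𝒜), ev (raw l) F = ev (raw l) G) : F = G := by
  funext n
  refine op_ext 𝒜 fun l => ?_
  rw [evOp_eq_ite, evOp_eq_ite, h]

/-- Linear maps agree if they agree on homogeneous elements. -/
theorem linear_ext {M : Type*} [AddCommGroup M] [Module k M] {f g : A →ₗ[k] M}
    (h : ∀ x : HomElt 𝒜, f x.2 = g x.2) : f = g := by
  ext a
  rw [← sum_parityProj 𝒜 a, map_sum, map_sum]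
  exact Finset.sum_congr rfl fun c _ => h ⟨c, _, parityProj_mem 𝒜 c a⟩

/-- The value of `F ⊼ G` on a list of homogeneous elements. -/
theorem evOp_wedge {i j n : ℕ} (h : i + j = n) (F : Op k A i) (G : Op k A j)
    (l : List (HomElt 𝒜)) :
    evOp (raw l) (wedge 𝒜 h F G) =
      unsh 𝒜 l (fun a b => evOp (evOp (raw a) G :: raw b) F) := by
  by_cases hl : l.length = n + 1
  · obtain ⟨w, rfl⟩ := exists_eq_ofFn hl
    -- A block `a` of the wrong length gives `G` the value zero, and `F` vanishes when its first
    -- argument does. The block size of the shuffle therefore need not be imposed.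
    have h1 : ∀ a b : List (HomElt 𝒜), (a ++ b).Perm (List.ofFn w) →
        evOp (evOp (raw a) G :: raw b) F =
          if a.length = j + 1 then evOp (evOp (raw a) G :: raw b) F else 0 := by
      intro a b _
      split_ifs with ha
      · rfl
      · rw [evOp_of_length_ne (l := raw a) (by simpa using ha), ← headOp_apply, map_zero]
    rw [unsh, unshuffleSum_congr k _ h1, ← sum_shuffles_eq_unshuffleSum k _ w (j + 1) (by omega)
      (fun a b => evOp (evOp (raw a) G :: raw b) F), raw_ofFn, evOp_ofFn, wedge, shuffleSum,
      sum_apply]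
    refine Finset.sum_congr rfl fun σ _ => ?_
    rw [signedPerm_apply_of_mem 𝒜 σ _ (fun i => (w i).1) _ (fun i => (w i).2.2),
      insertFirst_apply]
    have e1 : raw ((List.ofFn fun i => w (σ i)).take (j + 1)) =
        List.ofFn (fun a : Fin (j + 1) => ((w (σ ⟨a, by omega⟩)).2 : A)) := by
      refine List.ext_getElem (by simp; omega) fun l h1 h2 => ?_
      simp [raw, -List.ofFn_succ]
    have e2 : raw ((List.ofFn fun i => w (σ i)).drop (j + 1)) =
        List.ofFn (fun b : Fin i => ((w (σ ⟨j + 1 + b, by omega⟩)).2 : A)) := by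
      refine List.ext_getElem (by simp; omega) fun l h1 h2 => ?_
      simp [raw, -List.ofFn_succ]
    rw [e1, e2, evOp_ofFn, evOp_cons]
  · rw [evOp_of_length_ne (by simpa using hl)]
    refine (unshuffleSum_zero k _ l).symm.trans (unshuffleSum_congr k _ fun a b hab => ?_)
    by_cases ha : a.length = j + 1
    · have := hab.length_eq
      rw [List.length_append] at this
      rw [evOp_of_length_ne (l := _ :: raw b)]
      simp only [List.length_cons, length_raw]
      omega
    · rw [evOp_of_length_ne (l := raw a) (by simpa using ha), ← headOp_apply, map_zero]

/-- The product `F ⊼ G` of sequences of operators. -/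
def seqWedge (F G : OpSeq k A) : OpSeq k A := fun n =>
  ∑ i : Fin (n + 1), wedge 𝒜 (Nat.add_sub_of_le i.is_le) (F i) (G (n - i))

/-- The block sizes of an unshuffle determine which components of `F` and `G` can contribute, so the
sum over `i` disappears into the sum over all unshuffles. -/
theorem ev_seqWedge (F G : OpSeq k A) (l : List (HomElt 𝒜)) :
    ev (raw l) (seqWedge 𝒜 F G) = unsh 𝒜 l (fun a b => ev (ev (raw a) G :: raw b) F) := by
  rcases l with _ | ⟨x, l⟩
  · rw [raw_nil, ev_nil, unsh, unshuffleSum_nil, raw_nil, ev_nil, ← head_apply, map_zero]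
  · rw [ev_eq_evOp (n := l.length) (by simp), seqWedge, map_sum]
    simp only [evOp_wedge]
    rw [unsh, ← unshuffleSum_sum]
    refine unshuffleSum_congr k _ fun a b hab => ?_
    have hlen := hab.length_eq
    simp only [List.length_append, List.length_cons] at hlen
    rcases Nat.eq_zero_or_pos a.length with ha | ha
    · obtain rfl := List.length_eq_zero_iff.mp ha
      rw [raw_nil, ev_nil, ← head_apply, map_zero]
      refine Finset.sum_eq_zero fun i _ => ?_
      rw [evOp_of_length_ne (l := []) (by simp), ← headOp_apply, map_zero]
    · rw [Finset.sum_eq_single ⟨b.length, by omega⟩]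
      · rw [ev_eq_evOp (l := raw a) (n := l.length - b.length) (by simp; omega),
          ev_eq_evOp (n := b.length) (by simp)]
      · intro i _ hi
        refine evOp_of_length_ne ?_ _
        simp only [List.length_cons, length_raw]
        intro h
        exact hi (Fin.ext (by simp; omega))
      · simp

end Homogeneous

end Antibracket

namespace Antibracket

/-! ### The Lie superalgebra of sequences of operators -/

section Bracket

variable {k A : Type*} [Field k] [AddCommGroup A] [Module k A]
  (𝒜 : ZMod 2 → Submodule k A) [DirectSum.Decomposition 𝒜]

theorem evOp_opPart (d : ZMod 2) {n : ℕ} (F : Op k A n) (l : List (HomElt 𝒜)) :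
    evOp (raw l) (opPart 𝒜 d F) = parityProj 𝒜 (d + pr l) (evOp (raw l) F) := by
  by_cases hl : l.length = n + 1
  · obtain ⟨w, rfl⟩ := exists_eq_ofFn hl
    rw [raw_ofFn, evOp_ofFn, evOp_ofFn, pr_ofFn]
    simp only [opPart, sum_apply, LinearMap.compMultilinearMap_apply,
      MultilinearMap.compLinearMap_apply]
    rw [Finset.sum_eq_single fun i => (w i).1]
    · simp [parityProj_of_mem 𝒜 (w _).2.2]
    · intro q _ hq
      obtain ⟨i, hi⟩ := Function.ne_iff.mp hq
      rw [F.map_coord_zero i, map_zero]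
      simp [parityProj_of_mem 𝒜 (w i).2.2, hi]
    · simp
  · rw [evOp_of_length_ne (by simpa using hl), evOp_of_length_ne (by simpa using hl), map_zero]

/-- The component of parity `d` of a sequence of operators. -/
def seqPart (d : ZMod 2) : OpSeq k A →ₗ[k] OpSeq k A where
  toFun F n := opPart 𝒜 d (F n)
  map_add' F G := by
    funext n
    refine op_ext 𝒜 fun l => ?_
    simp [evOp_opPart]
  map_smul' c F := by
    funext n
    refine op_ext 𝒜 fun l => ?_
    simp [evOp_opPart]

theorem seqPart_apply (d : ZMod 2) (F : OpSeq k A) (n : ℕ) :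
    seqPart 𝒜 d F n = opPart 𝒜 d (F n) := rfl

theorem ev_seqPart (d : ZMod 2) (F : OpSeq k A) (l : List (HomElt 𝒜)) :
    ev (raw l) (seqPart 𝒜 d F) = parityProj 𝒜 (d + pr l) (ev (raw l) F) :=
  evOp_opPart 𝒜 d _ l

theorem seqPart_mem_seqOfParity (d : ZMod 2) (F : OpSeq k A) :
    seqPart 𝒜 d F ∈ seqOfParity 𝒜 d := by
  rw [mem_seqOfParity_iff]
  intro l
  rw [ev_seqPart]
  exact parityProj_mem 𝒜 _ _

theorem seqPart_mem_D {F : OpSeq k A} (hF : F ∈ D 𝒜) (d : ZMod 2) : seqPart 𝒜 d F ∈ D 𝒜 := by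
  rw [mem_D_iff] at hF ⊢
  intro l x y m
  simp only [ev_seqPart, hF l x y m, map_smul]
  have h : pr (l ++ x :: y :: m) = pr (l ++ y :: x :: m) := by simp; ring
  rw [h]

theorem sum_seqPart (F : OpSeq k A) : ∑ d, seqPart 𝒜 d F = F := by
  refine seq_ext 𝒜 fun l => ?_
  simp only [map_sum, ev_seqPart]
  exact (Fintype.sum_equiv (Equiv.addRight (pr l)) _ (fun c => parityProj 𝒜 c (ev (raw l) F))
    fun c => rfl).trans (sum_parityProj 𝒜 _)

theorem seqPart_of_mem {c : ZMod 2} {F : OpSeq k A} (hF : F ∈ seqOfParity 𝒜 c) (d : ZMod 2) :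
    seqPart 𝒜 d F = if d = c then F else 0 := by
  refine seq_ext 𝒜 fun l => ?_
  rw [ev_seqPart, parityProj_of_mem 𝒜 (mem_seqOfParity_iff.mp hF l)]
  simp only [add_left_inj]
  split_ifs <;> simp

/-- `F ⊼ G` as a bilinear map. -/
def seqWedgeHom : OpSeq k A →ₗ[k] OpSeq k A →ₗ[k] OpSeq k A :=
  LinearMap.mk₂ k (seqWedge 𝒜)
    (fun F F' G => seq_ext 𝒜 fun l => by simp only [map_add, ev_seqWedge, unsh, unshuffleSum_add])
    (fun c F G => seq_ext 𝒜 fun l => by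
      simp only [map_smul, ev_seqWedge, unsh, unshuffleSum_smul])
    (fun F G G' => seq_ext 𝒜 fun l => by
      simp only [map_add, ev_seqWedge, unsh, ← head_apply, unshuffleSum_add])
    (fun c F G => seq_ext 𝒜 fun l => by
      simp only [map_smul, ev_seqWedge, unsh, ← head_apply, unshuffleSum_smul])

theorem seqWedgeHom_apply (F G : OpSeq k A) : seqWedgeHom 𝒜 F G = seqWedge 𝒜 F G := rfl

/-- The types of the operators depend on the indices, so equal indices are exchanged here by
substitution. -/
theorem wedge_congr {i j i' j' n : ℕ} (F G : OpSeq k A) (hi : i = i') (hj : j = j')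
    (h : i + j = n) (h' : i' + j' = n) : wedge 𝒜 h (F i) (G j) = wedge 𝒜 h' (F i') (G j') := by
  subst hi hj
  rfl

theorem sum_wedge_rev (F G : OpSeq k A) (n : ℕ)
    (h : ∀ i : Fin (n + 1), n - (i : ℕ) + i = n) :
    ∑ i : Fin (n + 1), wedge 𝒜 (h i) (G (n - i)) (F i) = seqWedge 𝒜 G F n := by
  rw [seqWedge, ← Equiv.sum_comp Fin.revPerm]
  refine Finset.sum_congr rfl fun i _ => ?_
  have := i.is_le
  exact wedge_congr 𝒜 G F (by simp; omega) (by simp) _ _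

/-- The bracket as a bilinear map. -/
def bracketHom : OpSeq k A →ₗ[k] OpSeq k A →ₗ[k] OpSeq k A :=
  ∑ c : ZMod 2, ∑ d : ZMod 2, ((seqWedgeHom 𝒜).compl₁₂ (seqPart 𝒜 c) (seqPart 𝒜 d) -
    superSign k c d • (seqWedgeHom 𝒜).flip.compl₁₂ (seqPart 𝒜 c) (seqPart 𝒜 d))

theorem bracketHom_eq_sum (F G : OpSeq k A) : bracketHom 𝒜 F G =
    ∑ c : ZMod 2, ∑ d : ZMod 2, (seqWedge 𝒜 (seqPart 𝒜 c F) (seqPart 𝒜 d G) -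
      superSign k c d • seqWedge 𝒜 (seqPart 𝒜 d G) (seqPart 𝒜 c F)) := by
  simp only [bracketHom, LinearMap.sum_apply, LinearMap.sub_apply, LinearMap.smul_apply,
    LinearMap.compl₁₂_apply, LinearMap.flip_apply, seqWedgeHom_apply]

theorem seqBracket_eq (F G : OpSeq k A) : seqBracket 𝒜 F G = bracketHom 𝒜 F G := by
  rw [bracketHom_eq_sum]
  funext n
  simp only [seqBracket, nrBracket]
  rw [Finset.sum_comm]
  simp only [Finset.sum_apply]
  refine Finset.sum_congr rfl fun c _ => ?_
  rw [Finset.sum_comm]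
  refine Finset.sum_congr rfl fun d _ => ?_
  rw [Finset.sum_sub_distrib, ← Finset.smul_sum]
  have := sum_wedge_rev 𝒜 (seqPart 𝒜 c F) (seqPart 𝒜 d G) n (fun i => by have := i.is_le; omega)
  simp only [seqPart_apply] at this
  rw [this]
  rfl

theorem bracketHom_of_mem {c d : ZMod 2} {F G : OpSeq k A} (hF : F ∈ seqOfParity 𝒜 c)
    (hG : G ∈ seqOfParity 𝒜 d) : bracketHom 𝒜 F G =
      seqWedgeHom 𝒜 F G - superSign k c d • seqWedgeHom 𝒜 G F := by
  rw [bracketHom_eq_sum, Finset.sum_eq_single c, Finset.sum_eq_single d]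
  · simp [seqPart_of_mem 𝒜 hF, seqPart_of_mem 𝒜 hG, seqWedgeHom_apply]
  · intro e _ he
    simp [seqPart_of_mem 𝒜 hG, he, ← seqWedgeHom_apply]
  · simp
  · intro e _ he
    simp [seqPart_of_mem 𝒜 hF, he, ← seqWedgeHom_apply]
  · simp

variable {𝒜}

/-- In `F ⊼ G` the first argument of `F` is a value of `G`, which need not be homogeneous; linearity
in that argument reduces to the homogeneous case. -/
theorem listSupersymmetric_tail {F : OpSeq k A} (hF : F ∈ D 𝒜) (a : A) :
    ListSupersymmetric k Sigma.fst (fun l : List (HomElt 𝒜) => ev (a :: raw l) F) := by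
  rw [mem_D_iff] at hF
  intro l x y m
  have h : ∀ m m' : List (HomElt 𝒜), ∀ c : k,
      (∀ x : HomElt 𝒜, ev (raw (x :: m)) F = c • ev (raw (x :: m')) F) →
        ev (a :: raw m) F = c • ev (a :: raw m') F := by
    intro m m' c h
    have : head F (raw m) = c • head F (raw m') := linear_ext 𝒜 fun x => h x
    exact congrArg (fun f => f a) this
  exact h _ _ _ fun z => hF (z :: l) x y m

theorem seqWedge_mem_D {F G : OpSeq k A} (hF : F ∈ D 𝒜) (hG : G ∈ D 𝒜) :
    seqWedge 𝒜 F G ∈ D 𝒜 := by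
  rw [mem_D_iff]
  simp only [ev_seqWedge]
  refine listSupersymmetric_unshuffleSum k _ _ (fun b => ?_) (fun a => ?_)
  · intro l x y m
    rw [mem_D_iff] at hG
    simp only [hG l x y m, ← head_apply, map_smul]
  · exact listSupersymmetric_tail hF _

theorem seqWedge_mem_seqOfParity {c d : ZMod 2} {F G : OpSeq k A} (hF : F ∈ seqOfParity 𝒜 c)
    (hG : G ∈ seqOfParity 𝒜 d) : seqWedge 𝒜 F G ∈ seqOfParity 𝒜 (c + d) := by
  rw [mem_seqOfParity_iff] at hF hG ⊢
  intro l
  rw [ev_seqWedge]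
  refine unshuffleSum_mem k _ _ fun a b hab => ?_
  have := hF (⟨d + pr a, ev (raw a) G, hG a⟩ :: b)
  rw [raw_cons] at this
  have e : c + d + pr l = c + pr ((⟨d + pr a, ev (raw a) G, hG a⟩ : HomElt 𝒜) :: b) := by
    rw [pr, ← listParity_perm _ hab]
    simp
    ring
  rwa [e]

/-- The failure of associativity of `⊼`. -/
def wedgeAssociator (d : ZMod 2) (F G H : OpSeq k A) (l : List (HomElt 𝒜)) : A :=
  unsh 𝒜 l fun a b => unsh 𝒜 b fun b₁ b₂ =>
    superSign k (d + pr a) (pr b₁) • ev (ev (raw b₁) G :: ev (raw a) H :: raw b₂) F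

/-- In `(F ⊼ G) ⊼ H` the value of `H` is the first entry of the list given to `F ⊼ G`. If it is
unshuffled into the block of `G`, coassociativity gives `F ⊼ (G ⊼ H)`; otherwise it becomes a
separate argument of `F`. -/
theorem ev_seqWedge_seqWedge {d : ZMod 2} (F G : OpSeq k A) {H : OpSeq k A}
    (hH : H ∈ seqOfParity 𝒜 d) (l : List (HomElt 𝒜)) :
    ev (raw l) (seqWedge 𝒜 (seqWedge 𝒜 F G) H) =
      ev (raw l) (seqWedge 𝒜 F (seqWedge 𝒜 G H)) + wedgeAssociator d F G H l := by
  rw [mem_seqOfParity_iff] at hH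
  have h1 : ∀ a b : List (HomElt 𝒜), ev (ev (raw a) H :: raw b) (seqWedge 𝒜 F G) =
      unsh 𝒜 b (fun b₁ b₂ => ev (ev (ev (raw a) H :: raw b₁) G :: raw b₂) F) +
      unsh 𝒜 b (fun b₁ b₂ => superSign k (d + pr a) (pr b₁) •
        ev (ev (raw b₁) G :: ev (raw a) H :: raw b₂) F) := fun a b =>
    ev_seqWedge 𝒜 F G (⟨d + pr a, ev (raw a) H, hH a⟩ :: b)
  rw [ev_seqWedge]
  simp only [h1, unsh, unshuffleSum_add]
  rw [← unsh, ← unsh, ← wedgeAssociator]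
  congr 1
  rw [ev_seqWedge, unsh, ← unshuffleSum_assoc k Sigma.fst l (fun a b₁ b₂ =>
    ev (ev (ev (raw a) H :: raw b₁) G :: raw b₂) F)]
  refine unshuffleSum_congr k _ fun a b _ => ?_
  rw [ev_seqWedge, ← head_apply, map_unshuffleSum]
  rfl

/-- The associator feeds `G` and `H` with two disjoint blocks. Cocommutativity exchanges the blocks
and supersymmetry of `F` exchanges its first two arguments. -/
theorem wedgeAssociator_symm {c d : ZMod 2} {F G H : OpSeq k A} (hF : F ∈ D 𝒜)
    (hG : G ∈ seqOfParity 𝒜 c) (hH : H ∈ seqOfParity 𝒜 d) (l : List (HomElt 𝒜)) :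
    wedgeAssociator d F G H l = superSign k c d • wedgeAssociator c F H G l := by
  rw [mem_D_iff] at hF
  rw [mem_seqOfParity_iff] at hG hH
  rw [wedgeAssociator, wedgeAssociator, unsh, unsh,
    ← unshuffleSum_assoc k Sigma.fst l (fun a b₁ b₂ => superSign k (d + pr a) (pr b₁) •
      ev (ev (raw b₁) G :: ev (raw a) H :: raw b₂) F),
    ← unshuffleSum_assoc k Sigma.fst l (fun a b₁ b₂ => superSign k (c + pr a) (pr b₁) •
      ev (ev (raw b₁) H :: ev (raw a) G :: raw b₂) F), ← unshuffleSum_smul]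
  refine unshuffleSum_congr k _ fun a b _ => ?_
  rw [unshuffleSum_comm, ← unshuffleSum_smul]
  refine unshuffleSum_congr k _ fun a₁ a₂ _ => ?_
  have := hF [] ⟨c + pr a₁, ev (raw a₁) G, hG a₁⟩ ⟨d + pr a₂, ev (raw a₂) H, hH a₂⟩ b
  simp only [List.nil_append, raw_cons] at this
  rw [this, smul_smul, smul_smul, smul_smul]
  congr 1
  simp only [superSign_eq_paritySign, paritySign_mul]
  congr 1
  -- What remains is a comparison of exponents in `ZMod 2`, checked on all parities of `G`, `H` and
  -- the two blocks.
  change pr a₁ * pr a₂ + _ + _ = _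
  generalize pr a₁ = s
  generalize pr a₂ = t
  clear this hG hH
  revert c d s t
  decide

/-- The super pre-Lie identity. -/
theorem seqWedge_preLie {c d : ZMod 2} {F G H : OpSeq k A} (hF : F ∈ D 𝒜)
    (hG : G ∈ seqOfParity 𝒜 c) (hH : H ∈ seqOfParity 𝒜 d) :
    seqWedgeHom 𝒜 (seqWedgeHom 𝒜 F G) H - seqWedgeHom 𝒜 F (seqWedgeHom 𝒜 G H) =
      superSign k c d • (seqWedgeHom 𝒜 (seqWedgeHom 𝒜 F H) G -
        seqWedgeHom 𝒜 F (seqWedgeHom 𝒜 H G)) := by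
  refine seq_ext 𝒜 fun l => ?_
  simp only [map_sub, map_smul, seqWedgeHom_apply, ev_seqWedge_seqWedge F G hH,
    ev_seqWedge_seqWedge F H hG, add_sub_cancel_left]
  exact wedgeAssociator_symm hF hG hH l

theorem bracketHom_mem_D {F G : OpSeq k A} (hF : F ∈ D 𝒜) (hG : G ∈ D 𝒜) :
    bracketHom 𝒜 F G ∈ D 𝒜 := by
  rw [bracketHom_eq_sum]
  refine Submodule.sum_mem _ fun c _ => Submodule.sum_mem _ fun d _ => Submodule.sub_mem _ ?_ ?_
  · exact seqWedge_mem_D (seqPart_mem_D 𝒜 hF c) (seqPart_mem_D 𝒜 hG d)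
  · exact Submodule.smul_mem _ _
      (seqWedge_mem_D (seqPart_mem_D 𝒜 hG d) (seqPart_mem_D 𝒜 hF c))

theorem bracketHom_mem_seqOfParity {c d : ZMod 2} {F G : OpSeq k A}
    (hF : F ∈ seqOfParity 𝒜 c) (hG : G ∈ seqOfParity 𝒜 d) :
    bracketHom 𝒜 F G ∈ seqOfParity 𝒜 (c + d) := by
  rw [bracketHom_of_mem 𝒜 hF hG]
  refine Submodule.sub_mem _ (seqWedge_mem_seqOfParity hF hG) (Submodule.smul_mem _ _ ?_)
  rw [add_comm c d]
  exact seqWedge_mem_seqOfParity hG hF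

/-- Jacobi for the supercommutator of a pre-Lie product: one pre-Lie identity with each of `F`, `G`,
`H` in the leftmost place cancels all twelve terms. Beyond this only the value `±1` of the sign of
`F` and `G` is needed. -/
theorem bracketHom_jacobi_of_mem {c d e : ZMod 2} {F G H : OpSeq k A} (hF : F ∈ D 𝒜)
    (hG : G ∈ D 𝒜) (hH : H ∈ D 𝒜) (hFc : F ∈ seqOfParity 𝒜 c) (hGd : G ∈ seqOfParity 𝒜 d)
    (hHe : H ∈ seqOfParity 𝒜 e) :
    bracketHom 𝒜 F (bracketHom 𝒜 G H) = bracketHom 𝒜 (bracketHom 𝒜 F G) H +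
      superSign k c d • bracketHom 𝒜 G (bracketHom 𝒜 F H) := by
  rw [bracketHom_of_mem 𝒜 hFc (bracketHom_mem_seqOfParity hGd hHe),
    bracketHom_of_mem 𝒜 (bracketHom_mem_seqOfParity hFc hGd) hHe,
    bracketHom_of_mem 𝒜 hGd (bracketHom_mem_seqOfParity hFc hHe),
    bracketHom_of_mem 𝒜 hGd hHe, bracketHom_of_mem 𝒜 hFc hGd, bracketHom_of_mem 𝒜 hFc hHe]
  have h1 := seqWedge_preLie hF hGd hHe
  have h2 := seqWedge_preLie hG hFc hHe
  have h3 := seqWedge_preLie hH hFc hGd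
  rw [sub_eq_iff_eq_add] at h1 h2 h3
  simp only [map_sub, map_smul, LinearMap.sub_apply, LinearMap.smul_apply, h1, h2, h3,
    superSign_add_left, superSign_add_right, superSign_comm k d c]
  have s1 := superSign_mul_self k c d
  generalize superSign k c d = x at *
  generalize superSign k c e = y at *
  generalize superSign k d e = z at *
  rcases mul_self_eq_one_iff.mp s1 with rfl | rfl <;>
    simp only [smul_sub, smul_add, smul_smul] <;> match_scalars <;> ring

theorem bracketHom_jacobi {c d : ZMod 2} {F G H : OpSeq k A} (hF : F ∈ D 𝒜)
    (hG : G ∈ D 𝒜) (hH : H ∈ D 𝒜) (hFc : F ∈ seqOfParity 𝒜 c) (hGd : G ∈ seqOfParity 𝒜 d) :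
    bracketHom 𝒜 F (bracketHom 𝒜 G H) = bracketHom 𝒜 (bracketHom 𝒜 F G) H +
      superSign k c d • bracketHom 𝒜 G (bracketHom 𝒜 F H) := by
  rw [← sum_seqPart 𝒜 H]
  simp only [map_sum, Finset.smul_sum, ← Finset.sum_add_distrib]
  exact Finset.sum_congr rfl fun e _ => bracketHom_jacobi_of_mem hF hG (seqPart_mem_D 𝒜 hH e)
    hFc hGd (seqPart_mem_seqOfParity 𝒜 e H)

variable (𝒜)

theorem isLieSuperalgebra_D :
    IsLieSuperalgebra (D 𝒜) (seqOfParity 𝒜) (seqBracket 𝒜) where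
  decomp x hx := by
    refine ⟨(seqPart 𝒜 0 x, seqPart 𝒜 1 x), ⟨⟨seqPart_mem_D 𝒜 hx 0,
      seqPart_mem_seqOfParity 𝒜 0 x⟩, ⟨seqPart_mem_D 𝒜 hx 1, seqPart_mem_seqOfParity 𝒜 1 x⟩,
      (Fin.sum_univ_two _).symm.trans (sum_seqPart 𝒜 x)⟩, ?_⟩
    rintro ⟨y, z⟩ ⟨hy, hz, rfl⟩
    simp [seqPart_of_mem 𝒜 hy.2, seqPart_of_mem 𝒜 hz.2]
  closed x hx y hy := by
    rw [seqBracket_eq]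
    exact bracketHom_mem_D hx hy
  add_left x _ y _ z _ := by simp [seqBracket_eq]
  smul_left a x _ y _ := by simp [seqBracket_eq]
  add_right x _ y _ z _ := by simp [seqBracket_eq]
  smul_right a x _ y _ := by simp [seqBracket_eq]
  parity c d x hx y hy := by
    rw [seqBracket_eq]
    exact bracketHom_mem_seqOfParity hx.2 hy.2
  skew c d x hx y hy := by
    rw [seqBracket_eq, seqBracket_eq, bracketHom_of_mem 𝒜 hx.2 hy.2,
      bracketHom_of_mem 𝒜 hy.2 hx.2, smul_sub, superSign_comm k d c, superSign_smul_smul_self]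
    abel
  jacobi c d x hx y hy z hz := by
    simp only [seqBracket_eq]
    exact bracketHom_jacobi hx.1 hy.1 hz hx.2 hy.2

end Bracket

end Antibracket

namespace Antibracket

/-! ### Exponentials of operators that raise a filtration -/

section FilteredExp

variable {k V : Type*} [Field k] [AddCommGroup V] [Module k V]

/-- The truncated exponential `∑_{i < m} d^i / i!`. -/
def expTrunc (d : V →ₗ[k] V) (m : ℕ) : V →ₗ[k] V :=
  ∑ i ∈ Finset.range m, (i.factorial : k)⁻¹ • d ^ i

theorem expTrunc_apply (d : V →ₗ[k] V) (m : ℕ) (x : V) :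
    expTrunc d m x = ∑ i ∈ Finset.range m, (i.factorial : k)⁻¹ • (d ^ i) x := by
  simp [expTrunc]

/-- `y` is the exponential of `d` applied to `x`, in the topology given by the filtration `Φ`. -/
def IsExp (Φ : ℕ → Submodule k V) (d : V →ₗ[k] V) (x y : V) : Prop :=
  ∀ m, y - expTrunc d m x ∈ Φ m

/-- The operator `d` raises the filtration `Φ`. -/
def Raises (Φ : ℕ → Submodule k V) (d : V →ₗ[k] V) : Prop :=
  ∀ m, ∀ x ∈ Φ m, d x ∈ Φ (m + 1)

variable {Φ : ℕ → Submodule k V} {d : V →ₗ[k] V}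

theorem IsExp.unique (hΦ : ∀ x, (∀ m, x ∈ Φ m) → x = 0) {x y z : V} (hy : IsExp Φ d x y)
    (hz : IsExp Φ d x z) : y = z :=
  sub_eq_zero.mp <| hΦ _ fun m => by simpa using Submodule.sub_mem _ (hy m) (hz m)

theorem Raises.pow_mem (hd : Raises Φ d) (i : ℕ) {m : ℕ} {x : V} (hx : x ∈ Φ m) :
    (d ^ i) x ∈ Φ (m + i) := by
  induction i with
  | zero => simpa using hx
  | succ i ih =>
    rw [pow_succ', Module.End.mul_apply]
    exact hd _ _ ih

theorem Raises.expTrunc_mem (hd : Raises Φ d) (hanti : Antitone Φ) (n : ℕ) {m : ℕ} {x : V}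
    (hx : x ∈ Φ m) : expTrunc d n x ∈ Φ m := by
  rw [expTrunc_apply]
  exact Submodule.sum_mem _ fun i _ => Submodule.smul_mem _ _
    (hanti (Nat.le_add_right m i) (hd.pow_mem i hx))

theorem expTrunc_mem (L : Submodule k V)
    (hd : ∀ x ∈ L, d x ∈ L) (m : ℕ) {x : V} (hx : x ∈ L) :
    expTrunc d m x ∈ L := by
  rw [expTrunc_apply]
  refine Submodule.sum_mem _ fun i hi => Submodule.smul_mem _ _ ?_
  clear hi
  induction i with
  | zero => exact hx
  | succ i ih =>
    rw [pow_succ', Module.End.mul_apply]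
    exact hd _ ih

/-- The omitted terms involve at least `m` applications of `d`. Hence the truncations form a Cauchy
sequence for the filtration. -/
theorem Raises.expTrunc_sub_mem (hd : Raises Φ d) (hanti : Antitone Φ) (h0 : Φ 0 = ⊤)
    {m n : ℕ} (hmn : m ≤ n) (x : V) : expTrunc d n x - expTrunc d m x ∈ Φ m := by
  rw [expTrunc_apply, expTrunc_apply, ← Finset.sum_sdiff (Finset.range_mono hmn),
    add_sub_cancel_right]
  refine Submodule.sum_mem _ fun i hi => Submodule.smul_mem _ _ ?_
  simp only [Finset.mem_sdiff, Finset.mem_range, not_lt] at hi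
  have h := hd.pow_mem i (m := 0) (x := x) (by rw [h0]; trivial)
  exact hanti (by omega) h

/-- The square minus the triangle leaves only terms with `i + j ≥ m`. This is the Cauchy product of
two truncated series up to the filtration. -/
theorem sum_range_sub_sum_antidiagonal_mem (hanti : Antitone Φ) (f : ℕ → ℕ → V)
    (hf : ∀ i j, f i j ∈ Φ (i + j)) (m : ℕ) :
    ∑ i ∈ Finset.range m, ∑ j ∈ Finset.range m, f i j -
      ∑ n ∈ Finset.range m, ∑ ij ∈ Finset.HasAntidiagonal.antidiagonal n, f ij.1 ij.2 ∈ Φ m := by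
  simp only [Finset.Nat.sum_antidiagonal_eq_sum_range_succ f]
  rw [Finset.sum_range_diag_flip, ← Finset.sum_sub_distrib]
  refine Submodule.sum_mem _ fun i _ => ?_
  rw [← Finset.sum_sdiff (Finset.range_mono (Nat.sub_le m i)), add_sub_cancel_right]
  refine Submodule.sum_mem _ fun j hj => ?_
  simp only [Finset.mem_sdiff, Finset.mem_range, not_lt] at hj
  exact hanti (by omega) (hf i j)

theorem inv_factorial_mul_inv_factorial [CharZero k] (i j : ℕ) :
    (i.factorial : k)⁻¹ * (j.factorial : k)⁻¹ =
      ((i + j).factorial : k)⁻¹ * ((i + j).choose i : k) := by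
  have h := Nat.add_choose_mul_factorial_mul_factorial i j
  rw [← Nat.choose_symm_add] at h
  have hi : (i.factorial : k) ≠ 0 := Nat.cast_ne_zero.mpr i.factorial_ne_zero
  have hj : (j.factorial : k) ≠ 0 := Nat.cast_ne_zero.mpr j.factorial_ne_zero
  have hij : ((i + j).factorial : k) ≠ 0 := Nat.cast_ne_zero.mpr (i + j).factorial_ne_zero
  have h' : ((i + j).choose i : k) * i.factorial * j.factorial = (i + j).factorial := by
    exact_mod_cast h
  field_simp
  rw [← h']
  ring

/-- In the product of the two exponential series, the coefficient of `d ^ n` is `(-1 + 1) ^ n / n!`,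
so only the constant term survives. -/
theorem IsExp.neg [CharZero k] (hd : Raises Φ d) (hanti : Antitone Φ) (h0 : Φ 0 = ⊤) {x y : V}
    (h : IsExp Φ d x y) : IsExp Φ (-d) y x := by
  have hd' : Raises Φ (-d) := fun m x hx => Submodule.neg_mem _ (hd m x hx)
  intro m
  have h1 := hd'.expTrunc_mem hanti m (h m)
  rw [map_sub] at h1
  suffices h2 : expTrunc (-d) m (expTrunc d m x) - x ∈ Φ m by
    have := Submodule.neg_mem _ (Submodule.add_mem _ h1 h2)
    simpa using this
  rcases Nat.eq_zero_or_pos m with rfl | hm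
  · rw [h0]
    trivial
  have h3 := sum_range_sub_sum_antidiagonal_mem hanti (fun i j =>
    ((i.factorial : k)⁻¹ * (j.factorial : k)⁻¹ * (-1) ^ i) • (d ^ (i + j)) x) (fun i j => by
      have := hd.pow_mem (i + j) (m := 0) (x := x) (by rw [h0]; trivial)
      rw [zero_add] at this
      exact Submodule.smul_mem _ _ this) m
  convert h3 using 2
  · rw [expTrunc_apply]
    refine Finset.sum_congr rfl fun i _ => ?_
    rw [expTrunc_apply, map_sum, Finset.smul_sum]
    refine Finset.sum_congr rfl fun j _ => ?_
    rw [neg_pow, map_smul, ← neg_one_smul k (1 : V →ₗ[k] V), smul_pow, one_pow, smul_one_mul,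
      LinearMap.smul_apply, pow_add, Module.End.mul_apply, smul_smul, smul_smul]
  · have h4 : ∀ n ∈ Finset.range m, ∑ ij ∈ Finset.HasAntidiagonal.antidiagonal n,
        ((ij.1.factorial : k)⁻¹ * (ij.2.factorial : k)⁻¹ * (-1) ^ ij.1) • (d ^ (ij.1 + ij.2)) x =
        if n = 0 then x else 0 := by
      intro n _
      have h5 := (Commute.all (-1 : k) 1).add_pow' n
      have h6 : ∀ ij ∈ Finset.HasAntidiagonal.antidiagonal n,
          ((ij.1.factorial : k)⁻¹ * (ij.2.factorial : k)⁻¹ * (-1) ^ ij.1) •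
            (d ^ (ij.1 + ij.2)) x = (n.choose ij.1 • ((-1 : k) ^ ij.1 * 1 ^ ij.2)) •
            (n.factorial : k)⁻¹ • (d ^ n) x := by
        intro ij hij
        rw [Finset.HasAntidiagonal.mem_antidiagonal] at hij
        rw [inv_factorial_mul_inv_factorial, hij, smul_smul, nsmul_eq_mul]
        congr 1
        ring
      rw [Finset.sum_congr rfl h6, ← Finset.sum_smul, ← h5, neg_add_cancel, zero_pow_eq]
      split_ifs with hn
      · subst hn
        simp
      · simp
    rw [Finset.sum_congr rfl h4, Finset.sum_ite_eq', if_pos (Finset.mem_range.mpr hm)]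

variable {V₁ V₂ : Type*} [AddCommGroup V₁] [Module k V₁] [AddCommGroup V₂] [Module k V₂]

/-- The iterated Leibniz rule. It is assumed only along the orbits of `a` and `b` because, for the
bracket, the derivation property is available on `D` and not on all sequences. -/
theorem pow_apply_bilinear (B : V₁ →ₗ[k] V₂ →ₗ[k] V) (d₁ : V₁ →ₗ[k] V₁) (d₂ : V₂ →ₗ[k] V₂)
    (d : V →ₗ[k] V) (a : V₁) (b : V₂)
    (hB : ∀ i j, d (B ((d₁ ^ i) a) ((d₂ ^ j) b)) =
      B ((d₁ ^ (i + 1)) a) ((d₂ ^ j) b) + B ((d₁ ^ i) a) ((d₂ ^ (j + 1)) b)) (n : ℕ) :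
    (d ^ n) (B a b) =
      ∑ ij ∈ Finset.HasAntidiagonal.antidiagonal n, n.choose ij.1 • B ((d₁ ^ ij.1) a) ((d₂ ^ ij.2) b) := by
  induction n with
  | zero => simp
  | succ n ih =>
    rw [Finset.sum_antidiagonal_choose_succ_nsmul (fun i j => B ((d₁ ^ i) a) ((d₂ ^ j) b)),
      pow_succ', Module.End.mul_apply, ih, map_sum, ← Finset.sum_add_distrib]
    refine Finset.sum_congr rfl fun ij hij => ?_
    rw [Finset.HasAntidiagonal.mem_antidiagonal] at hij
    have h : n.choose ij.1 = n.choose ij.2 := by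
      rw [← hij, Nat.choose_symm_add]
    rw [map_nsmul, hB, smul_add, add_comm, h]

/-- The exponential of a derivation is multiplicative. -/
theorem IsExp.bilinear [CharZero k] {Φ₁ : ℕ → Submodule k V₁} {Φ₂ : ℕ → Submodule k V₂}
    {d₁ : V₁ →ₗ[k] V₁} {d₂ : V₂ →ₗ[k] V₂} (B : V₁ →ₗ[k] V₂ →ₗ[k] V)
    (hBΦ : ∀ i j, ∀ x ∈ Φ₁ i, ∀ y ∈ Φ₂ j, B x y ∈ Φ (i + j)) (hanti : Antitone Φ)
    (h1 : Φ₁ 0 = ⊤) (h2 : Φ₂ 0 = ⊤) (hd1 : Raises Φ₁ d₁) (hd2 : Raises Φ₂ d₂)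
    {a a' : V₁} {b b' : V₂}
    (hB : ∀ i j, d (B ((d₁ ^ i) a) ((d₂ ^ j) b)) =
      B ((d₁ ^ (i + 1)) a) ((d₂ ^ j) b) + B ((d₁ ^ i) a) ((d₂ ^ (j + 1)) b))
    (ha : IsExp Φ₁ d₁ a a') (hb : IsExp Φ₂ d₂ b b') : IsExp Φ d (B a b) (B a' b') := by
  intro m
  -- Modulo `Φ m` both exponentials may be replaced by truncations, one argument at a time.
  have e1 : B a' b' - B (expTrunc d₁ m a) (expTrunc d₂ m b) ∈ Φ m := by
    have := Submodule.add_mem _ (hBΦ m 0 _ (ha m) b' (by rw [h2]; trivial))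
      (hanti (Nat.le_add_left m 0) (hBΦ 0 m (expTrunc d₁ m a) (by rw [h1]; trivial) _ (hb m)))
    simpa using this
  have e2 := sum_range_sub_sum_antidiagonal_mem hanti (fun i j =>
    ((i.factorial : k)⁻¹ * (j.factorial : k)⁻¹) • B ((d₁ ^ i) a) ((d₂ ^ j) b)) (fun i j => by
      have ha := hd1.pow_mem i (m := 0) (x := a) (by rw [h1]; trivial)
      have hb := hd2.pow_mem j (m := 0) (x := b) (by rw [h2]; trivial)
      rw [zero_add] at ha hb
      exact Submodule.smul_mem _ _ (hBΦ _ _ _ ha _ hb)) m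
  have e3 : B (expTrunc d₁ m a) (expTrunc d₂ m b) = ∑ i ∈ Finset.range m, ∑ j ∈ Finset.range m,
      ((i.factorial : k)⁻¹ * (j.factorial : k)⁻¹) • B ((d₁ ^ i) a) ((d₂ ^ j) b) := by
    rw [expTrunc_apply, expTrunc_apply]
    simp only [map_sum, LinearMap.sum_apply, map_smul, LinearMap.smul_apply, mul_smul,
      Finset.smul_sum]
    rw [Finset.sum_comm]
    exact Finset.sum_congr rfl fun i _ => Finset.sum_congr rfl fun j _ => smul_comm _ _ _
  have e4 : expTrunc d m (B a b) = ∑ n ∈ Finset.range m, ∑ ij ∈ Finset.HasAntidiagonal.antidiagonal n,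
      ((ij.1.factorial : k)⁻¹ * (ij.2.factorial : k)⁻¹) •
        B ((d₁ ^ ij.1) a) ((d₂ ^ ij.2) b) := by
    rw [expTrunc_apply]
    refine Finset.sum_congr rfl fun n _ => ?_
    rw [pow_apply_bilinear B d₁ d₂ d a b hB, Finset.smul_sum]
    refine Finset.sum_congr rfl fun ij hij => ?_
    rw [Finset.HasAntidiagonal.mem_antidiagonal] at hij
    rw [inv_factorial_mul_inv_factorial, hij, mul_smul, Nat.cast_smul_eq_nsmul]
  rw [← e3, ← e4] at e2
  simpa using Submodule.add_mem _ e1 e2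

theorem IsExp.map_of_commute {x y : V} (h : IsExp Φ d x y) (T : V →ₗ[k] V)
    (hT : ∀ m, ∀ x ∈ Φ m, T x ∈ Φ m) (hcomm : ∀ x, T (d x) = d (T x)) :
    IsExp Φ d (T x) (T y) := by
  intro m
  have h1 : ∀ i, T ((d ^ i) x) = (d ^ i) (T x) := by
    intro i
    induction i with
    | zero => rfl
    | succ i ih => rw [pow_succ', Module.End.mul_apply, Module.End.mul_apply, hcomm, ih]
  have h2 := hT m _ (h m)
  rw [map_sub, expTrunc_apply, map_sum] at h2
  simpa only [map_smul, h1, ← expTrunc_apply] using h2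

end FilteredExp

end Antibracket

namespace Antibracket

/-! ### The flow of the Koszul vector field -/

section PowerSeriesFlow

open PowerSeries

variable {k : Type*} [Field k]

variable (k) in
/-- The filtration of the power series ring by powers of `X`. -/
noncomputable def powFilt (m : ℕ) : Submodule k k⟦X⟧ :=
  (Ideal.span {(X : k⟦X⟧) ^ m}).restrictScalars k

theorem mem_powFilt {m : ℕ} {P : k⟦X⟧} : P ∈ powFilt k m ↔ X ^ m ∣ P := by
  simp [powFilt, Ideal.mem_span_singleton]

theorem powFilt_antitone : Antitone (powFilt k) := fun m n hmn P hP => by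
  rw [mem_powFilt] at hP ⊢
  exact (pow_dvd_pow X hmn).trans hP

theorem powFilt_zero : powFilt k 0 = ⊤ := by
  ext P
  simp [mem_powFilt]

theorem powFilt_separated (P : k⟦X⟧) (h : ∀ m, P ∈ powFilt k m) : P = 0 := by
  ext n
  exact (X_pow_dvd_iff.mp (mem_powFilt.mp (h (n + 1)))) n (Nat.lt_succ_self n)

theorem powFilt_mul (i j : ℕ) (P : k⟦X⟧) (hP : P ∈ powFilt k i) (Q : k⟦X⟧)
    (hQ : Q ∈ powFilt k j) : LinearMap.mul k k⟦X⟧ P Q ∈ powFilt k (i + j) := by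
  rw [mem_powFilt] at *
  rw [pow_add]
  exact mul_dvd_mul hP hQ

theorem X_pow_dvd_derivative {m : ℕ} {P : k⟦X⟧} (hP : X ^ m ∣ P) : X ^ (m - 1) ∣ d⁄dX k P := by
  obtain ⟨Q, rfl⟩ := hP
  rw [Derivation.leibniz, Derivation.leibniz_pow]
  refine dvd_add ?_ ?_
  · exact ((pow_dvd_pow X (Nat.sub_le m 1)).mul_right _)
  · simp only [smul_eq_mul, nsmul_eq_mul]
    exact Dvd.intro_left (Q * m * d⁄dX k X) (by ring)

/-- The action of the vector field `K d/dX` on functions twisted by `r K'`; the values `r = 1`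
and `r = -1` give the actions on one-forms and on vector fields. -/
noncomputable def twistedField (r : k) (K : k⟦X⟧) : k⟦X⟧ →ₗ[k] k⟦X⟧ :=
  LinearMap.mulLeft k K ∘ₗ (d⁄dX k).toLinearMap + r • LinearMap.mulLeft k (d⁄dX k K)

theorem twistedField_apply (r : k) (K P : k⟦X⟧) :
    twistedField r K P = K * d⁄dX k P + r • (d⁄dX k K * P) := rfl

/-- A double zero of `K` outweighs the one order lost by differentiating `P` or `K`. -/
theorem twistedField_raises {K : k⟦X⟧} (hK : X ^ 2 ∣ K) (r : k) :
    Raises (powFilt k) (twistedField r K) := by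
  intro m P hP
  rw [mem_powFilt] at hP ⊢
  rw [twistedField_apply]
  rw [PowerSeries.smul_eq_C_mul]
  refine dvd_add ?_ (Dvd.dvd.mul_left ?_ _)
  · refine (pow_dvd_pow X (show m + 1 ≤ 2 + (m - 1) by omega)).trans ?_
    rw [pow_add]
    exact mul_dvd_mul hK (X_pow_dvd_derivative hP)
  · rw [add_comm, pow_add]
    exact mul_dvd_mul (X_pow_dvd_derivative hK) hP

/-- The weights of the twists add under multiplication; this makes the flows of weights `1` and `-1`
reciprocal to each other on `1`. -/
theorem twistedField_leibniz {r s t : k} (h : r + s = t) (K P Q : k⟦X⟧) :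
    twistedField t K (P * Q) = twistedField r K P * Q + P * twistedField s K Q := by
  subst h
  simp only [twistedField_apply, Derivation.leibniz, smul_eq_mul, add_smul, PowerSeries.smul_eq_C_mul]
  ring

/-- The formal exponential of an operator on power series. -/
noncomputable def powExp (d : k⟦X⟧ →ₗ[k] k⟦X⟧) : k⟦X⟧ →ₗ[k] k⟦X⟧ where
  toFun P := mk fun n => coeff n (expTrunc d (n + 1) P)
  map_add' P Q := by ext n; simp
  map_smul' c P := by ext n; simp

theorem isExp_powExp {d : k⟦X⟧ →ₗ[k] k⟦X⟧} (hd : Raises (powFilt k) d) (P : k⟦X⟧) :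
    IsExp (powFilt k) d P (powExp d P) := by
  intro m
  rw [mem_powFilt, X_pow_dvd_iff]
  intro n hn
  have h := hd.expTrunc_sub_mem powFilt_antitone powFilt_zero (show n + 1 ≤ m from hn) P
  rw [mem_powFilt, X_pow_dvd_iff] at h
  have := h n (Nat.lt_succ_self n)
  rw [map_sub, sub_eq_zero] at this
  simp [powExp, this]

theorem powExp_mul [CharZero k] {r s t : k} (h : r + s = t) {K : k⟦X⟧} (hK : X ^ 2 ∣ K)
    (P Q : k⟦X⟧) : powExp (twistedField t K) (P * Q) =
      powExp (twistedField r K) P * powExp (twistedField s K) Q := by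
  refine IsExp.unique powFilt_separated (isExp_powExp (twistedField_raises hK t) _) ?_
  refine IsExp.bilinear (LinearMap.mul k k⟦X⟧) powFilt_mul powFilt_antitone powFilt_zero
    powFilt_zero (twistedField_raises hK r) (twistedField_raises hK s) (fun i j => ?_)
    (isExp_powExp (twistedField_raises hK r) P) (isExp_powExp (twistedField_raises hK s) Q)
  simp only [LinearMap.mul_apply', pow_succ', Module.End.mul_apply]
  exact twistedField_leibniz h _ _ _

theorem powExp_one {K : k⟦X⟧} (hK : X ^ 2 ∣ K) : powExp (twistedField 0 K) 1 = 1 := by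
  refine IsExp.unique powFilt_separated (isExp_powExp (twistedField_raises hK 0) _) ?_
  intro m
  rcases Nat.eq_zero_or_pos m with rfl | hm
  · rw [powFilt_zero]
    trivial
  · have h : ∀ i ∈ Finset.range m, ((i.factorial : k)⁻¹ • (twistedField 0 K ^ i) 1 : k⟦X⟧) =
        if i = 0 then 1 else 0 := by
      intro i _
      rcases i with _ | i
      · simp
      · rw [pow_succ, Module.End.mul_apply]
        simp [twistedField_apply]
    rw [expTrunc_apply, Finset.sum_congr rfl h, Finset.sum_ite_eq', if_pos (by simpa using hm),
      sub_self]
    exact Submodule.zero_mem _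

/-- The flow of `K d/dX` as an algebra endomorphism. -/
noncomputable def flow [CharZero k] {K : k⟦X⟧} (hK : X ^ 2 ∣ K) : k⟦X⟧ →ₐ[k] k⟦X⟧ :=
  AlgHom.ofLinearMap (powExp (twistedField 0 K)) (powExp_one hK) (powExp_mul (add_zero 0) hK)

theorem flow_apply [CharZero k] {K : k⟦X⟧} (hK : X ^ 2 ∣ K) (P : k⟦X⟧) :
    flow hK P = powExp (twistedField 0 K) P := rfl

/-- The exponential of the field commutes with the field, and `K` is the field applied to `X`. -/
theorem flow_self [CharZero k] {K : k⟦X⟧} (hK : X ^ 2 ∣ K) :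
    flow hK K = K * d⁄dX k (flow hK X) := by
  have h1 : twistedField 0 K X = K := by simp [twistedField_apply]
  have h2 : K * d⁄dX k (flow hK X) = twistedField 0 K (flow hK X) := by
    simp [twistedField_apply]
  have hd := twistedField_raises hK (0 : k)
  rw [h2, flow_apply, flow_apply]
  refine IsExp.unique powFilt_separated (isExp_powExp hd K) ?_
  have := (isExp_powExp hd X).map_of_commute (twistedField 0 K)
    (fun m x hx => powFilt_antitone (Nat.le_succ m) (hd m x hx)) (fun _ => rfl)
  rwa [h1] at this

/-- The second iterate of the field on `X` is `K K'`, already of order three. -/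
theorem flow_X_sub_dvd [CharZero k] {K : k⟦X⟧} (hK : X ^ 2 ∣ K) :
    X ^ 3 ∣ flow hK X - (X + K) := by
  have hd := twistedField_raises hK (0 : k)
  have h1 : twistedField 0 K X = K := by simp [twistedField_apply]
  have h := isExp_powExp hd X 3
  have h2 : expTrunc (twistedField 0 K) 3 X =
      X + K + ((2 : ℕ).factorial : k)⁻¹ • twistedField 0 K K := by
    simp [expTrunc_apply, Finset.sum_range_succ, pow_two, h1]
  have h3 := Submodule.smul_mem _ ((2 : ℕ).factorial : k)⁻¹ (hd 2 K (mem_powFilt.mpr hK))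
  rw [h2] at h
  have := Submodule.add_mem _ h h3
  rw [mem_powFilt] at this
  convert this using 1
  rw [flow_apply]
  abel

/-- No continuity of the algebra maps is assumed: writing `P = c + X Q` and passing to `Q`, each
step gains one factor `C₂ X`, which is divisible by `X`. -/
theorem algHom_sub_dvd {C₁ C₂ : k⟦X⟧ →ₐ[k] k⟦X⟧} (h2 : X ∣ C₂ X) {m : ℕ}
    (h : X ^ m ∣ C₁ X - C₂ X) (P : k⟦X⟧) : X ^ m ∣ C₁ P - C₂ P := by
  have key : ∀ j ≤ m, ∀ P : k⟦X⟧, X ^ j ∣ C₁ P - C₂ P := by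
    intro j
    induction j with
    | zero => intro _ P; simp
    | succ j ih =>
      intro hj P
      obtain ⟨Q, hQ⟩ : ∃ Q, P = algebraMap k k⟦X⟧ (constantCoeff P) + X * Q := by
        refine ⟨mk fun n => coeff (n + 1) P, ?_⟩
        rw [add_comm]
        exact eq_X_mul_shift_add_const P
      have e : C₁ P - C₂ P = (C₁ X - C₂ X) * C₁ Q + C₂ X * (C₁ Q - C₂ Q) := by
        rw [hQ]
        simp only [map_add, map_mul, AlgHom.commutes]
        ring
      rw [e]
      refine dvd_add (((pow_dvd_pow X hj).trans h).mul_right _) ?_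
      rw [pow_succ']
      exact mul_dvd_mul h2 (ih (by omega) Q)
  exact key m le_rfl P

theorem constantCoeff_algHom {C : k⟦X⟧ →ₐ[k] k⟦X⟧} (h : X ∣ C X) (P : k⟦X⟧) :
    constantCoeff (C P) = constantCoeff P := by
  have e : C P = algebraMap k k⟦X⟧ (constantCoeff P) + C X * C (mk fun n => coeff (n + 1) P) := by
    conv_lhs => rw [eq_X_mul_shift_add_const P]
    rw [map_add, map_mul, add_comm]
    congr 1
    exact C.commutes _
  rw [e, map_add, map_mul, X_dvd_iff.mp h, zero_mul, add_zero]
  rfl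

/-- Uniqueness of the flow of `K d/dX` with given second order part. -/
theorem algHom_X_unique [CharZero k] {K S : k⟦X⟧} (hK : K = X ^ 2 * S)
    (hS : constantCoeff S = 1 / 2) {C₁ C₂ : k⟦X⟧ →ₐ[k] k⟦X⟧}
    (h1 : C₁ K = K * d⁄dX k (C₁ X)) (h2 : C₂ K = K * d⁄dX k (C₂ X))
    (h3 : X ^ 2 ∣ C₂ X - X) (h4 : X ^ 3 ∣ C₁ X - C₂ X) : C₁ X = C₂ X := by
  obtain ⟨b, hb⟩ := h3
  have hb' : C₂ X = X * (1 + X * b) := by linear_combination hb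
  have hdvd2 : X ∣ C₂ X := ⟨_, hb'⟩
  -- Let `C₁ X - C₂ X = X ^ m ε`. In degree `m + 1` the two expressions for `C₁ K - C₂ K` give `(m /
  -- 2) ε(0) = ε(0)`, since `K = X ^ 2 / 2 + ⋯`. Hence `ε(0) = 0` for `m ≥ 3`; the case `m = 2` is
  -- the freedom removed by `h4`.
  have key : ∀ m, 3 ≤ m → X ^ m ∣ C₁ X - C₂ X := by
    intro m hm
    induction m, hm using Nat.le_induction with
    | base => exact h4
    | succ m hm ih =>
      obtain ⟨n, rfl⟩ : ∃ n, m = n + 3 := ⟨m - 3, by omega⟩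
      obtain ⟨T, hT⟩ := algHom_sub_dvd hdvd2 ih S
      obtain ⟨ε, hε⟩ := ih
      have ha' : C₁ X = X * (1 + X * b + X ^ (n + 2) * ε) := by
        linear_combination hε + hb'
      have hdvd1 : X ∣ C₁ X := ⟨_, ha'⟩
      have hS1 : constantCoeff (C₁ S) = 1 / 2 := by rw [constantCoeff_algHom hdvd1, hS]
      have hD : d⁄dX k (C₁ X) - d⁄dX k (C₂ X) =
          ((n : k⟦X⟧) + 3) * X ^ (n + 2) * ε + X ^ (n + 3) * d⁄dX k ε := by
        rw [← map_sub, hε, Derivation.leibniz, Derivation.leibniz_pow, derivative_X]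
        simp only [smul_eq_mul, nsmul_eq_mul]
        push_cast
        ring
      have e1 : C₁ K - C₂ K = K * (d⁄dX k (C₁ X) - d⁄dX k (C₂ X)) := by
        rw [h1, h2]
        ring
      have e2 : C₁ K - C₂ K = (C₁ X - C₂ X) * (C₁ X + C₂ X) * C₁ S +
          C₂ X ^ 2 * (C₁ S - C₂ S) := by
        rw [hK]
        simp only [map_mul, map_pow]
        ring
      rw [e1, hD, hε, ha', hb', hT, hK] at e2
      have e3 : X ^ (n + 4) * (S * (((n : k⟦X⟧) + 3) * ε + X * d⁄dX k ε)) =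
          X ^ (n + 4) * (ε * (2 + 2 * X * b + X ^ (n + 2) * ε) * C₁ S +
            X * (1 + X * b) ^ 2 * T) := by
        linear_combination e2
      have e4 := mul_left_cancel₀ (pow_ne_zero _ X_ne_zero) e3
      have e5 := congrArg constantCoeff e4
      simp only [map_mul, map_add, hS, hS1, constantCoeff_X, map_natCast, map_ofNat, map_pow,
        zero_mul, mul_zero, add_zero, zero_pow (Nat.succ_ne_zero (n + 1))] at e5
      -- The factor `n + 1` is `m - 2`.
      have hn : ((n : k) + 1) ≠ 0 := Nat.cast_add_one_ne_zero n
      have e6 : constantCoeff ε = 0 := by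
        have : ((n : k) + 1) * constantCoeff ε = 0 := by linear_combination 2 * e5
        exact (mul_eq_zero.mp this).resolve_left hn
      obtain ⟨η, rfl⟩ := X_dvd_iff.mpr e6
      exact ⟨η, by rw [hε]; ring⟩
  rw [← sub_eq_zero]
  refine powFilt_separated _ fun m => mem_powFilt.mpr ?_
  exact (pow_dvd_pow X (Nat.le_add_right m 3)).trans (key (m + 3) (by omega))

end PowerSeriesFlow

end Antibracket

namespace Antibracket

/-! ### The Koszul series -/

section KoszulSeries

open PowerSeries

variable (k : Type*) [Field k] [CharZero k]

/-- With `m = n + 1`, the term `i = m` has coefficient `m (m + 1) / 2`, which exceeds `(m + 2)(m -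
1) / 2` by `1`. The recursion for `K_m` is therefore this homogeneous identity. -/
theorem sum_stirlingSecond_koszulNumber (n : ℕ) :
    ∑ i ∈ Finset.range (n + 2), (Nat.stirlingSecond (n + 2) i : ℚ) * koszulNumber i =
      koszulNumber (n + 1) := by
  rw [Finset.sum_range_succ', Finset.sum_range_succ]
  simp only [Nat.stirlingSecond_succ_zero, Nat.cast_zero, zero_mul, add_zero]
  cases n with
  | zero => simp [koszulNumber, Nat.stirlingSecond_one_right]
  | succ n =>
    rw [Nat.stirlingSecond_succ_self_left, koszulNumber, Finset.sum_range, Nat.cast_choose_two]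
    have h1 : ((n : ℚ) + 4) ≠ 0 := by positivity
    have h2 : ((n : ℚ) + 1) ≠ 0 := by positivity
    push_cast
    field_simp
    ring

/-- The series `∑ K_n X^(n+1) / (n+1)!`. -/
noncomputable def koszulSeries (k : Type*) [Field k] : k⟦X⟧ :=
  mk fun n => (koszulNumber (n - 1) : k) / (n.factorial : k)

theorem coeff_derivative_koszulSeries (n : ℕ) :
    coeff n (d⁄dX k (koszulSeries k)) = (koszulNumber n : k) / (n.factorial : k) := by
  have h1 : ((n : k) + 1) ≠ 0 := Nat.cast_add_one_ne_zero n
  have h2 : (n.factorial : k) ≠ 0 := Nat.cast_ne_zero.mpr n.factorial_ne_zero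
  rw [coeff_derivative, koszulSeries, coeff_mk, Nat.add_sub_cancel, Nat.factorial_succ]
  push_cast
  field_simp

theorem X_sq_dvd_koszulSeries (k : Type*) [Field k] : X ^ 2 ∣ koszulSeries k := by
  rw [X_pow_dvd_iff]
  intro m hm
  interval_cases m <;> simp [koszulSeries, koszulNumber]

theorem coeff_exp_eq (n : ℕ) : coeff n (exp k) = (n.factorial : k)⁻¹ := by
  simp

theorem constantCoeff_exp_sub_one : constantCoeff (exp k - 1) = 0 := by simp

/-- The derivative of `(exp - 1) ^ (d + 1)` is `d + 1` times `(exp - 1) ^ (d + 1) + (exp - 1) ^ d`,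
which is the Stirling recurrence. -/
theorem coeff_exp_sub_one_pow (n d : ℕ) :
    (n.factorial : k) * coeff n ((exp k - 1) ^ d) =
      (d.factorial : k) * (Nat.stirlingSecond n d : k) := by
  induction n generalizing d with
  | zero =>
    cases d with
    | zero => simp
    | succ d => simp
  | succ n ih =>
    cases d with
    | zero => simp [coeff_one]
    | succ d =>
      have h1 : ((n : k) + 1) ≠ 0 := Nat.cast_add_one_ne_zero n
      have h2 : d⁄dX k ((exp k - 1) ^ (d + 1)) =
          (d + 1 : k) • ((exp k - 1) ^ (d + 1) + (exp k - 1) ^ d) := by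
        rw [Derivation.leibniz_pow, map_sub, derivative_exp, derivative_one,
          PowerSeries.smul_eq_C_mul]
        simp only [smul_eq_mul, nsmul_eq_mul, Nat.add_sub_cancel, map_add, map_natCast, map_one]
        push_cast
        ring
      have h3 := congrArg (coeff n) h2
      rw [coeff_derivative, map_smul, map_add, smul_eq_mul] at h3
      rw [Nat.factorial_succ, Nat.stirlingSecond_succ_succ, Nat.factorial_succ d]
      have h4 := ih (d + 1)
      have h5 := ih d
      rw [Nat.factorial_succ d] at h4
      push_cast at h4 ⊢
      linear_combination (n.factorial : k) * h3 + ((d : k) + 1) * (h4 + h5)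

theorem hasSubst_exp_sub_one : HasSubst (exp k - 1) :=
  HasSubst.of_constantCoeff_zero' (constantCoeff_exp_sub_one k)

theorem coeff_subst_exp_sub_one (P : k⟦X⟧) (n : ℕ) :
    (n.factorial : k) * coeff n (P.subst (exp k - 1)) = ∑ d ∈ Finset.range (n + 1),
      coeff d P * ((d.factorial : k) * (Nat.stirlingSecond n d : k)) := by
  rw [coeff_subst' (hasSubst_exp_sub_one k), 
    finsum_eq_sum_of_support_subset (s := Finset.range (n + 1)), Finset.mul_sum]
  · refine Finset.sum_congr rfl fun d _ => ?_
    rw [← coeff_exp_sub_one_pow, smul_eq_mul]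
    ring
  · intro d hd
    by_contra h
    simp only [Finset.coe_range, Set.mem_Iio, not_lt] at h
    have h1 := coeff_exp_sub_one_pow k n d
    rw [Nat.stirlingSecond_eq_zero_of_lt (by omega), Nat.cast_zero, mul_zero] at h1
    have h2 := (mul_eq_zero.mp h1).resolve_left (Nat.cast_ne_zero.mpr n.factorial_ne_zero)
    simp [h2] at hd

/-- The Koszul recursion as a functional equation: substituting `exp - 1` applies the Stirling
matrix to the numbers `K_d`. The diagonal term gives `K_n` and the remaining ones sum to `K_(n-1)`.
-/
theorem subst_derivative_koszulSeries :
    (d⁄dX k (koszulSeries k)).subst (exp k - 1) =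
      koszulSeries k + d⁄dX k (koszulSeries k) := by
  ext n
  have hn : (n.factorial : k) ≠ 0 := Nat.cast_ne_zero.mpr n.factorial_ne_zero
  refine mul_left_cancel₀ hn ?_
  rw [coeff_subst_exp_sub_one, map_add, coeff_derivative_koszulSeries, koszulSeries, coeff_mk]
  have h1 : ∀ d ∈ Finset.range (n + 1), coeff d (d⁄dX k (koszulSeries k)) *
      ((d.factorial : k) * (Nat.stirlingSecond n d : k)) =
      (((Nat.stirlingSecond n d : ℚ) * koszulNumber d : ℚ) : k) := by
    intro d _
    have hd : (d.factorial : k) ≠ 0 := Nat.cast_ne_zero.mpr d.factorial_ne_zero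
    rw [coeff_derivative_koszulSeries]
    push_cast
    field_simp
  rw [koszulSeries] at h1
  rw [Finset.sum_congr rfl h1, ← Rat.cast_sum, mul_add, mul_div_cancel₀ _ hn, mul_div_cancel₀ _ hn,
    ← Rat.cast_add]
  congr 1
  -- The recursion applies from degree two on; degrees `0` and `1` are direct.
  rcases n with _ | _ | n
  · simp [koszulNumber]
  · simp [Finset.sum_range_succ, koszulNumber, Nat.stirlingSecond_self]
  · rw [Finset.sum_range_succ, sum_stirlingSecond_koszulNumber, Nat.stirlingSecond_self]
    simp

/-- Julia's equation for the Koszul series. -/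
theorem subst_koszulSeries :
    (koszulSeries k).subst (exp k - 1) = koszulSeries k * exp k := by
  refine derivative.ext ?_ ?_
  -- By the chain rule both derivatives are `(K + K') exp`.
  · rw [derivative_subst (hasSubst_exp_sub_one k), subst_derivative_koszulSeries,
      Derivation.leibniz, map_sub, derivative_exp, derivative_one]
    simp only [smul_eq_mul]
    ring
  · have h := X_sq_dvd_koszulSeries k
    have h1 : constantCoeff (koszulSeries k) = 0 :=
      X_dvd_iff.mp ((dvd_pow_self X two_ne_zero).trans h)
    rw [map_mul, h1, zero_mul]
    exact constantCoeff_subst_eq_zero (constantCoeff_exp_sub_one k) _ h1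

/-- The time one flow of the Koszul vector field is `exp - 1`. -/
theorem powExp_koszulSeries_X :
    powExp (twistedField 0 (koszulSeries k)) X = exp k - 1 := by
  have hK := X_sq_dvd_koszulSeries k
  obtain ⟨S, hS⟩ := id hK
  have hS0 : constantCoeff S = 1 / 2 := by
    have h := congrArg (coeff 2) hS
    rw [coeff_X_pow_mul' S 2 2] at h
    simp only [le_refl, if_true, Nat.sub_self, coeff_zero_eq_constantCoeff] at h
    rw [← h]
    simp [koszulSeries, koszulNumber]
  have hX : substAlgHom (hasSubst_exp_sub_one k) (X : k⟦X⟧) = exp k - 1 :=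
    substAlgHom_X _
  have hdvd : X ^ 3 ∣ (exp k - 1) - (X + koszulSeries k) := by
    rw [X_pow_dvd_iff]
    intro m hm
    interval_cases m <;>
      simp [koszulSeries, koszulNumber, coeff_one, coeff_X, Nat.factorial]
  have h1 : X ^ 3 ∣ flow hK X - (exp k - 1) := by
    have := dvd_sub (flow_X_sub_dvd hK) hdvd
    rwa [sub_sub_sub_cancel_right] at this
  have h2 : X ^ 2 ∣ (exp k - 1) - X := by
    have h3 := dvd_add ((pow_dvd_pow X (show 2 ≤ 3 by norm_num)).trans hdvd) hK
    convert h3 using 1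
    ring
  -- Julia's equation says that substitution of `exp - 1` is an algebra map with the same functional
  -- equation as the flow.
  have := algHom_X_unique (C₁ := flow hK) (C₂ := (substAlgHom (hasSubst_exp_sub_one k)))
    hS hS0 (flow_self hK) ?_ ?_ ?_
  · rw [← flow_apply hK, this, hX]
  · rw [hX, coe_substAlgHom, subst_koszulSeries, map_sub, derivative_exp, derivative_one, sub_zero]
  · rwa [hX]
  · rwa [hX]

theorem derivative_twistedField {k : Type*} [Field k] (K P : k⟦X⟧) :
    d⁄dX k (twistedField 0 K P) = twistedField 1 K (d⁄dX k P) := by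
  simp only [twistedField_apply, zero_smul, one_smul, add_zero, Derivation.leibniz, smul_eq_mul]
  ring

/-- Differentiation intertwines the actions of weight `0` and weight `1`, so the flow of `1 = dX/dX`
is the derivative of the flow of `X`. -/
theorem powExp_koszulSeries_one : powExp (twistedField 1 (koszulSeries k)) 1 = exp k := by
  have hK := X_sq_dvd_koszulSeries k
  have hd0 := twistedField_raises hK (0 : k)
  have hd1 := twistedField_raises hK (1 : k)
  refine IsExp.unique powFilt_separated (isExp_powExp hd1 1) ?_
  intro m
  -- One extra order compensates for the differentiation below.
  have h1 := isExp_powExp hd0 X (m + 1)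
  rw [powExp_koszulSeries_X, mem_powFilt] at h1
  have h2 := X_pow_dvd_derivative h1
  have h3 : ∀ i, d⁄dX k ((twistedField 0 (koszulSeries k) ^ i) X) =
      (twistedField 1 (koszulSeries k) ^ i) 1 := by
    intro i
    induction i with
    | zero => simp
    | succ i ih =>
      rw [pow_succ', Module.End.mul_apply, derivative_twistedField, ih, pow_succ',
        Module.End.mul_apply]
  rw [map_sub, map_sub, derivative_exp, derivative_one, sub_zero, expTrunc_apply, map_sum] at h2
  simp only [Derivation.map_smul, h3, ← expTrunc_apply, Nat.add_sub_cancel] at h2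
  have h4 := hd1.expTrunc_sub_mem powFilt_antitone powFilt_zero (Nat.le_succ m) 1
  have := Submodule.add_mem _ (mem_powFilt.mpr h2) h4
  simpa using this

/-- Weights `1` and `-1` add up to `0`, so this flow is the inverse of the weight one flow of `1`,
which is `exp`. -/
theorem powExp_koszulSeries_neg_one :
    powExp (twistedField (-1) (koszulSeries k)) 1 = evalNegHom (exp k) := by
  have hK := X_sq_dvd_koszulSeries k
  have h := powExp_mul (add_neg_cancel (1 : k)) hK 1 1
  rw [mul_one, powExp_one hK, powExp_koszulSeries_one] at h
  have h2 := exp_mul_exp_neg_eq_one (A := k)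
  calc powExp (twistedField (-1) (koszulSeries k)) 1
      = (exp k * evalNegHom (exp k)) * powExp (twistedField (-1) (koszulSeries k)) 1 := by
        rw [h2, one_mul]
    _ = evalNegHom (exp k) * (exp k * powExp (twistedField (-1) (koszulSeries k)) 1) := by ring
    _ = evalNegHom (exp k) := by rw [← h, mul_one]

end KoszulSeries

end Antibracket

namespace Antibracket

/-! ### Products and antibrackets in terms of generating series -/

section Products

open PowerSeries

variable {k A : Type*} [Field k] [NonUnitalRing A] [Module k A] [IsScalarTower k A A]
  [SMulCommClass k A A]

/-- The coefficients of an exponential generating series. -/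
noncomputable def egf (n : ℕ) : k⟦X⟧ →ₗ[k] k := (n.factorial : k) • coeff n

theorem egf_apply (n : ℕ) (P : k⟦X⟧) : egf n P = (n.factorial : k) * coeff n P := rfl

theorem egf_derivative (n : ℕ) (P : k⟦X⟧) : egf n (d⁄dX k P) = egf (n + 1) P := by
  rw [egf_apply, egf_apply, coeff_derivative, Nat.factorial_succ]
  push_cast
  ring

variable (k) in
/-- The product of a list in the unitization. -/
def listProd (l : List A) : Unitization k A := (l.map (Unitization.inr (R := k))).prod

@[simp] theorem listProd_nil : listProd k ([] : List A) = 1 := rfl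

@[simp] theorem listProd_cons (a : A) (l : List A) :
    listProd k (a :: l) = (a : Unitization k A) * listProd k l := by simp [listProd]

theorem evOp_mulOp {n : ℕ} {l : List A} (h : l.length = n + 1) :
    ((evOp l (mulOp (k := k) n) : A) : Unitization k A) = listProd k l := by
  induction n generalizing l with
  | zero =>
    obtain ⟨v, rfl⟩ := exists_eq_ofFn h
    rw [evOp_ofFn, mulOp_zero_apply]
    simp
  | succ n ih =>
    obtain ⟨v, rfl⟩ := exists_eq_ofFn h
    rw [evOp_ofFn, mulOp_succ_apply, Unitization.inr_mul, ← evOp_ofFn, ih (by simp),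
      List.ofFn_succ (f := v), listProd_cons]

/-- The sequence of operators `∑ γ_n μ_n`, where `γ_n` are the coefficients of the exponential
generating series `Γ`, with a shift of index. -/
noncomputable def muSeq (Γ : k⟦X⟧) : OpSeq k A := fun n => egf (n + 1) Γ • mulOp n

theorem ev_cons_muSeq (Γ : k⟦X⟧) (a : A) (l : List A) :
    ((ev (a :: l) (muSeq Γ) : A) : Unitization k A) =
      egf (l.length + 1) Γ • ((a : Unitization k A) * listProd k l) := by
  rw [ev_eq_evOp (n := l.length) rfl, muSeq, map_smul, Unitization.inr_smul, evOp_mulOp rfl,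
    listProd_cons]

theorem ev_muSeq {Γ : k⟦X⟧} (hΓ : constantCoeff Γ = 0) (l : List A) :
    ((ev l (muSeq Γ) : A) : Unitization k A) = egf l.length Γ • listProd k l := by
  cases l with
  | nil => simp [egf_apply, hΓ]
  | cons a l => rw [ev_cons_muSeq, listProd_cons, List.length_cons]

/-- The extension of a linear endomorphism to the unitization by zero on scalars. -/
def extendLinear (f : A →ₗ[k] A) : Unitization k A →ₗ[k] Unitization k A :=
  Unitization.inrHom k k A ∘ₗ f ∘ₗ Unitization.sndHom k k A

@[simp] theorem extendLinear_one (f : A →ₗ[k] A) : extendLinear f 1 = 0 := by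
  simp [extendLinear]

@[simp] theorem extendLinear_inr (f : A →ₗ[k] A) (a : A) :
    extendLinear f (a : Unitization k A) = (f a : Unitization k A) := by
  simp [extendLinear]

theorem evOp_compMultilinearMap {n : ℕ} (f : A →ₗ[k] A) (F : Op k A n) (l : List A) :
    evOp l (f.compMultilinearMap F) = f (evOp l F) := by
  rw [evOp_apply, evOp_apply]
  split_ifs <;> simp

variable (𝒜 : ZMod 2 → Submodule k A)

section Commutative

variable {𝒜} (hcomm : ∀ c d : ZMod 2, ∀ a ∈ 𝒜 c, ∀ b ∈ 𝒜 d, a * b = superSign k c d • (b * a))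
include hcomm

theorem inr_mul_inr_comm (x y : HomElt 𝒜) :
    ((x.2 : A) : Unitization k A) * ((y.2 : A) : Unitization k A) =
      superSign k x.1 y.1 • (((y.2 : A) : Unitization k A) * ((x.2 : A) : Unitization k A)) := by
  rw [← Unitization.inr_mul, hcomm x.1 y.1 _ x.2.2 _ y.2.2, Unitization.inr_smul,
    Unitization.inr_mul]

theorem inr_mul_listProd_comm (x : HomElt 𝒜) (l : List (HomElt 𝒜)) :
    ((x.2 : A) : Unitization k A) * listProd k (raw l) =
      superSign k x.1 (pr l) • (listProd k (raw l) * ((x.2 : A) : Unitization k A)) := by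
  induction l with
  | nil => simp
  | cons y l ih =>
    rw [raw_cons, listProd_cons, pr, listParity_cons, superSign_add_right, ← mul_assoc,
      inr_mul_inr_comm hcomm, smul_mul_assoc, mul_assoc, ih, mul_smul_comm, smul_smul, mul_assoc]

theorem listSupersymmetric_listProd :
    ListSupersymmetric k Sigma.fst (fun l : List (HomElt 𝒜) => listProd k (raw l)) := by
  intro l x y m
  induction l with
  | nil =>
    simp only [List.nil_append, raw_cons, listProd_cons, ← mul_assoc]
    rw [inr_mul_inr_comm hcomm, smul_mul_assoc]
  | cons z l ih =>
    simp only [List.cons_append, raw_cons, listProd_cons] at ih ⊢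
    rw [ih, mul_smul_comm]

/-- Unshuffled products are counted by the product of exponential generating series. -/
theorem unsh_listProd (P Q : k⟦X⟧) (l : List (HomElt 𝒜)) :
    unsh 𝒜 l (fun a b => (egf a.length P * egf b.length Q) •
      (listProd k (raw a) * listProd k (raw b))) = egf l.length (P * Q) • listProd k (raw l) := by
  induction l generalizing P Q with
  | nil => simp [unsh, unshuffleSum_nil, egf_apply]
  | cons x l ih =>
    -- Removing the head `x` differentiates the generating series; the two terms of `(P Q)'`
    -- correspond to the two blocks in which `x` can land.
    rw [unsh, unshuffleSum_cons, List.length_cons, ← egf_derivative, Derivation.leibniz, map_add,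
      add_smul, raw_cons, listProd_cons, add_comm]
    have e : ∀ P Q : k⟦X⟧, egf l.length (P * Q) •
        (((x.2 : A) : Unitization k A) * listProd k (raw l)) =
        unsh 𝒜 l fun a b => (egf a.length P * egf b.length Q) •
          (((x.2 : A) : Unitization k A) * (listProd k (raw a) * listProd k (raw b))) := by
      intro P Q
      rw [← mul_smul_comm, ← ih P Q]
      refine (map_unshuffleSum k Sigma.fst
        (LinearMap.mulLeft k ((x.2 : A) : Unitization k A)) l _).trans ?_
      simp only [LinearMap.mulLeft_apply, mul_smul_comm]
    simp only [smul_eq_mul]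
    rw [mul_comm Q, e, e]
    congr 1
    · refine unshuffleSum_congr k _ fun a b _ => ?_
      rw [egf_derivative, raw_cons, listProd_cons, List.length_cons, smul_comm,
        ← smul_mul_assoc, ← mul_assoc, ← mul_assoc, inr_mul_listProd_comm hcomm, smul_mul_assoc]
    · refine unshuffleSum_congr k _ fun a b _ => ?_
      rw [egf_derivative, raw_cons, listProd_cons, List.length_cons, mul_assoc]

theorem muSeq_mem_D (Γ : k⟦X⟧) : muSeq Γ ∈ D 𝒜 := by
  rw [mem_D_iff]
  intro l x y m
  refine Unitization.inr_injective (R := k) ?_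
  simp only
  have h := listSupersymmetric_listProd hcomm l x y m
  simp only at h
  rw [Unitization.inr_smul]
  have h1 : ∀ z w : HomElt 𝒜, ((ev (raw (l ++ z :: w :: m)) (muSeq Γ) : A) : Unitization k A) =
      egf (l.length + m.length + 2) Γ • listProd k (raw (l ++ z :: w :: m)) := by
    intro z w
    have hlen : (raw (l ++ z :: w :: m)).length = (l.length + m.length + 1) + 1 := by
      simp
      omega
    rw [ev_eq_evOp hlen, muSeq, map_smul, Unitization.inr_smul, evOp_mulOp hlen]
  rw [h1, h1, h, smul_comm]

end Commutative

theorem evOp_mulOp_mem {𝒜 : ZMod 2 → Submodule k A} [SetLike.GradedMul 𝒜] {n : ℕ}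
    (l : List (HomElt 𝒜)) : evOp (raw l) (mulOp (k := k) n) ∈ 𝒜 (pr l) := by
  induction n generalizing l with
  | zero =>
    by_cases h : l.length = 1
    · obtain ⟨w, rfl⟩ := exists_eq_ofFn h
      rw [raw_ofFn, evOp_ofFn, mulOp_zero_apply, pr_ofFn, Fin.sum_univ_one]
      exact (w 0).2.2
    · rw [evOp_of_length_ne (by simpa using h)]
      exact Submodule.zero_mem _
  | succ n ih =>
    by_cases h : l.length = n + 2
    · obtain ⟨w, rfl⟩ := exists_eq_ofFn h
      have h2 := ih (List.ofFn fun i => w i.succ)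
      rw [raw_ofFn, evOp_ofFn, pr_ofFn] at h2
      rw [raw_ofFn, evOp_ofFn, mulOp_succ_apply, pr_ofFn, Fin.sum_univ_succ]
      exact SetLike.mul_mem_graded (w 0).2.2 h2
    · rw [evOp_of_length_ne (by simpa using h)]
      exact Submodule.zero_mem _

theorem muSeq_mem_seqOfParity [SetLike.GradedMul 𝒜] (Γ : k⟦X⟧) :
    muSeq Γ ∈ seqOfParity 𝒜 0 := by
  rw [mem_seqOfParity_iff]
  intro l
  rw [zero_add]
  rw [ev, LinearMap.comp_apply, LinearMap.proj_apply, muSeq, map_smul]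
  exact Submodule.smul_mem _ _ (evOp_mulOp_mem l)

variable [DirectSum.Decomposition 𝒜]

/-- The combinations `∑ p_a q_b μ_b ⊼ (f ∘ μ_a)` with the coefficients of the exponential generating
series `P` and `Q`. -/
noncomputable def antiSeq (f : A →ₗ[k] A) : k⟦X⟧ →ₗ[k] k⟦X⟧ →ₗ[k] OpSeq k A :=
  LinearMap.mk₂ k (fun P Q n => ∑ j : Fin (n + 1), (egf ((j : ℕ) + 1) P * egf (n - (j : ℕ)) Q) •
      wedge 𝒜 (Nat.sub_add_cancel j.is_le) (mulOp (n - (j : ℕ)))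
        (f.compMultilinearMap (mulOp (j : ℕ))))
    (fun P P' Q => by
      funext n
      simp only [map_add, add_mul, add_smul, Finset.sum_add_distrib, Pi.add_apply])
    (fun c P Q => by
      funext n
      simp only [map_smul, smul_mul_assoc, smul_assoc, Finset.smul_sum, Pi.smul_apply])
    (fun P Q Q' => by
      funext n
      simp only [map_add, mul_add, add_smul, Finset.sum_add_distrib, Pi.add_apply])
    (fun c P Q => by
      funext n
      simp only [map_smul, mul_smul_comm, smul_assoc, Finset.smul_sum, Pi.smul_apply])

theorem antiSeq_apply (f : A →ₗ[k] A) (P Q : k⟦X⟧) (n : ℕ) :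
    antiSeq 𝒜 f P Q n = ∑ j : Fin (n + 1), (egf ((j : ℕ) + 1) P * egf (n - (j : ℕ)) Q) •
      wedge 𝒜 (Nat.sub_add_cancel j.is_le) (mulOp (n - (j : ℕ)))
        (f.compMultilinearMap (mulOp (j : ℕ))) := rfl

/-- In the unitization empty blocks need no separate treatment: an empty second block has product
`1`, and an empty first block contributes nothing because the extension of `f` kills scalars. -/
theorem ev_antiSeq (f : A →ₗ[k] A) (P Q : k⟦X⟧) (l : List (HomElt 𝒜)) :
    ((ev (raw l) (antiSeq 𝒜 f P Q) : A) : Unitization k A) =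
      unsh 𝒜 l (fun a b => (egf a.length P * egf b.length Q) •
        (extendLinear f (listProd k (raw a)) * listProd k (raw b))) := by
  rcases l with _ | ⟨x, l⟩
  · simp [unsh, unshuffleSum_nil]
  · rw [ev_eq_evOp (n := l.length) (by simp), antiSeq_apply, map_sum]
    simp only [map_smul, evOp_wedge]
    simp only [unsh, ← unshuffleSum_smul]
    rw [← unshuffleSum_sum, ← Unitization.inrHom_apply k k, map_unshuffleSum]
    refine unshuffleSum_congr k _ fun a b hab => ?_
    have hlen := hab.length_eq
    simp only [List.length_append, List.length_cons] at hlen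
    simp only [evOp_compMultilinearMap]
    rcases Nat.eq_zero_or_pos a.length with ha | ha
    · obtain rfl := List.length_eq_zero_iff.mp ha
      rw [raw_nil, listProd_nil, extendLinear_one, zero_mul, smul_zero, Finset.sum_eq_zero, map_zero]
      intro i _
      rw [evOp_of_length_ne (l := []) (by simp), map_zero, ← headOp_apply, map_zero, smul_zero]
    · rw [Finset.sum_eq_single ⟨a.length - 1, by omega⟩]
      · have h1 : (raw a).length = (a.length - 1) + 1 := by simp; omega
        have h2 : ∀ y : A, (y :: raw b).length = (l.length - (a.length - 1)) + 1 := by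
          intro y
          simp only [List.length_cons, length_raw]
          omega
        rw [map_smul, Unitization.inrHom_apply, evOp_mulOp (h2 _), listProd_cons,
          ← extendLinear_inr, evOp_mulOp h1]
        congr 2
        · have e1 : a.length - 1 + 1 = a.length := by omega
          simp only [e1]
        · have e2 : l.length - (a.length - 1) = b.length := by omega
          simp only [e2]
      · intro i _ hi
        rw [evOp_of_length_ne (l := _ :: raw b), smul_zero]
        simp only [List.length_cons, length_raw]
        intro h
        have := i.2
        exact hi (Fin.ext (by simp only; omega))
      · simp

variable {𝒜} (hcomm : ∀ c d : ZMod 2, ∀ a ∈ 𝒜 c, ∀ b ∈ 𝒜 d, a * b = superSign k c d • (b * a))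
include hcomm

theorem unsh_mul_unsh_listProd (g : Unitization k A) (P Q : k⟦X⟧) (l : List (HomElt 𝒜)) :
    unsh 𝒜 l (fun a b => (egf a.length P * egf b.length Q) •
      (g * (listProd k (raw a) * listProd k (raw b)))) =
      egf l.length (P * Q) • (g * listProd k (raw l)) := by
  rw [← mul_smul_comm, ← unsh_listProd hcomm]
  refine Eq.symm ((map_unshuffleSum k Sigma.fst (LinearMap.mulLeft k g) l _).trans ?_)
  simp only [LinearMap.mulLeft_apply, mul_smul_comm]

/-- The outer product multiplies the existing factor by further arguments, so coassociativity merges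
the two into one block. One slot of the outer product holds the inserted value, hence the derivative
of `Γ`. -/
theorem seqWedge_muSeq_antiSeq (f : A →ₗ[k] A) (Γ P Q : k⟦X⟧) :
    seqWedge 𝒜 (muSeq Γ) (antiSeq 𝒜 f P Q) = antiSeq 𝒜 f P (Q * d⁄dX k Γ) := by
  refine seq_ext 𝒜 fun l => Unitization.inr_injective (R := k) ?_
  rw [ev_antiSeq, ev_seqWedge, ← Unitization.inrHom_apply k k, unsh, map_unshuffleSum]
  simp only [Unitization.inrHom_apply, ev_cons_muSeq, ev_antiSeq, length_raw]
  have h1 : ∀ a b : List (HomElt 𝒜), egf (b.length + 1) Γ •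
      ((unsh 𝒜 a fun a₁ a₂ => (egf a₁.length P * egf a₂.length Q) •
        (extendLinear f (listProd k (raw a₁)) * listProd k (raw a₂))) * listProd k (raw b)) =
      unsh 𝒜 a fun a₁ a₂ => egf a₁.length P • ((egf a₂.length Q * egf b.length (d⁄dX k Γ)) •
        (extendLinear f (listProd k (raw a₁)) * (listProd k (raw a₂) * listProd k (raw b)))) := by
    intro a b
    rw [← egf_derivative]
    refine (map_unshuffleSum k Sigma.fst (egf b.length (d⁄dX k Γ) •
      LinearMap.mulRight k (listProd k (raw b))) a _).trans ?_
    refine unshuffleSum_congr k _ fun a₁ a₂ _ => ?_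
    simp only [LinearMap.smul_apply, LinearMap.mulRight_apply, smul_mul_assoc, smul_smul, mul_assoc]
    congr 1
    ring
  simp only [h1]
  rw [unsh, unshuffleSum_assoc k Sigma.fst l (fun a₁ a₂ b => egf a₁.length P •
    ((egf a₂.length Q * egf b.length (d⁄dX k Γ)) •
      (extendLinear f (listProd k (raw a₁)) * (listProd k (raw a₂) * listProd k (raw b)))))]
  refine unshuffleSum_congr k _ fun a b _ => ?_
  rw [unshuffleSum_smul]
  refine (congrArg _ (unsh_mul_unsh_listProd hcomm _ _ _ b)).trans ?_
  rw [smul_smul]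

/-- The inserted product occupies one slot either inside `f` or among the outer factors. This
differentiates `P` or `Q`, and the inserted arguments then join that block with series `Γ`. -/
theorem seqWedge_antiSeq_muSeq [SetLike.GradedMul 𝒜] (f : A →ₗ[k] A) {Γ : k⟦X⟧}
    (hΓ : constantCoeff Γ = 0) (P Q : k⟦X⟧) :
    seqWedge 𝒜 (antiSeq 𝒜 f P Q) (muSeq Γ) =
      antiSeq 𝒜 f (Γ * d⁄dX k P) Q + antiSeq 𝒜 f P (Γ * d⁄dX k Q) := by
  refine seq_ext 𝒜 fun l => Unitization.inr_injective (R := k) ?_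
  simp only [map_add, Unitization.inr_add]
  rw [ev_antiSeq, ev_antiSeq, ev_seqWedge, ← Unitization.inrHom_apply k k, unsh, map_unshuffleSum]
  simp only [Unitization.inrHom_apply]
  have hpar := mem_seqOfParity_iff.mp (muSeq_mem_seqOfParity 𝒜 Γ)
  have h1 : ∀ a b : List (HomElt 𝒜),
      ((ev (ev (raw a) (muSeq Γ) :: raw b) (antiSeq 𝒜 f P Q) : A) : Unitization k A) =
      (unsh 𝒜 b fun b₁ b₂ => egf b₂.length Q • ((egf a.length Γ * egf b₁.length (d⁄dX k P)) •
        (extendLinear f (listProd k (raw a) * listProd k (raw b₁)) * listProd k (raw b₂)))) +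
      unsh 𝒜 b fun b₁ b₂ => superSign k (pr a) (pr b₁) • egf b₁.length P •
        ((egf a.length Γ * egf b₂.length (d⁄dX k Q)) •
        (extendLinear f (listProd k (raw b₁)) * (listProd k (raw a) * listProd k (raw b₂)))) := by
    intro a b
    have := ev_antiSeq 𝒜 f P Q (⟨0 + pr a, ev (raw a) (muSeq Γ), hpar a⟩ :: b)
    rw [raw_cons] at this
    simp only at this
    rw [this, unsh, unshuffleSum_cons]
    simp only [raw_cons, listProd_cons, ev_muSeq hΓ, List.length_cons, zero_add, length_raw]
    congr 1
    · refine unshuffleSum_congr k _ fun b₁ b₂ _ => ?_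
      rw [smul_mul_assoc, map_smul, smul_mul_assoc, smul_smul, smul_smul, egf_derivative]
      congr 1
      ring
    · refine unshuffleSum_congr k _ fun b₁ b₂ _ => ?_
      rw [smul_mul_assoc, mul_smul_comm, egf_derivative]
      simp only [smul_smul]
      congr 1
      ring
  simp only [h1]
  rw [unshuffleSum_add]
  congr 1
  · rw [← unshuffleSum_assoc k Sigma.fst l (fun a b₁ b₂ => egf b₂.length Q •
      ((egf a.length Γ * egf b₁.length (d⁄dX k P)) •
        (extendLinear f (listProd k (raw a) * listProd k (raw b₁)) * listProd k (raw b₂))))]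
    refine unshuffleSum_congr k _ fun a b _ => ?_
    have h2 := map_unshuffleSum k Sigma.fst (LinearMap.mulRight k (listProd k (raw b)) ∘ₗ
      extendLinear f) a (fun a₁ a₂ => (egf a₁.length Γ * egf a₂.length (d⁄dX k P)) •
        (listProd k (raw a₁) * listProd k (raw a₂)))
    rw [unshuffleSum_smul]
    rw [mul_comm (egf a.length (Γ * d⁄dX k P)), mul_smul]
    congr 1
    refine Eq.trans ?_ (h2.symm.trans ?_)
    · simp only [map_smul, LinearMap.comp_apply, LinearMap.mulRight_apply]
    · refine (congrArg _ (unsh_listProd hcomm _ _ a)).trans ?_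
      simp only [map_smul, LinearMap.comp_apply, LinearMap.mulRight_apply]
  · rw [← unshuffleSum_assoc k Sigma.fst l (fun a b₁ b₂ => superSign k (pr a) (pr b₁) •
      egf b₁.length P • ((egf a.length Γ * egf b₂.length (d⁄dX k Q)) •
        (extendLinear f (listProd k (raw b₁)) * (listProd k (raw a) * listProd k (raw b₂)))))]
    -- The block of `f` has been moved in front of the inserted product; cocommutativity absorbs the
    -- resulting sign.
    have h2 : ∀ a b : List (HomElt 𝒜), unshuffleSum k Sigma.fst a (fun a₁ a₂ =>
        superSign k (pr a₁) (pr a₂) • egf a₂.length P •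
          ((egf a₁.length Γ * egf b.length (d⁄dX k Q)) • (extendLinear f (listProd k (raw a₂)) *
            (listProd k (raw a₁) * listProd k (raw b))))) =
        unshuffleSum k Sigma.fst a (fun a₁ a₂ => egf a₁.length P •
          ((egf a₂.length Γ * egf b.length (d⁄dX k Q)) • (extendLinear f (listProd k (raw a₁)) *
            (listProd k (raw a₂) * listProd k (raw b))))) := fun a b =>
      (unshuffleSum_comm k Sigma.fst a _).symm
    simp only [h2]
    rw [unshuffleSum_assoc k Sigma.fst l (fun a₁ a₂ b => egf a₁.length P •
          ((egf a₂.length Γ * egf b.length (d⁄dX k Q)) • (extendLinear f (listProd k (raw a₁)) *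
            (listProd k (raw a₂) * listProd k (raw b)))))]
    refine unshuffleSum_congr k _ fun a b _ => ?_
    rw [unshuffleSum_smul]
    refine (congrArg _ (unsh_mul_unsh_listProd hcomm _ _ _ b)).trans ?_
    rw [smul_smul]

end Products

end Antibracket

namespace Antibracket

/-! ### The exponential of the Koszul generator -/

section Exponential

open PowerSeries

section Filtration

variable {k A : Type*} [Field k] [AddCommGroup A] [Module k A]

/-- Sequences of operators that vanish below the index `m`. -/
def seqFilt (m : ℕ) : Submodule k (OpSeq k A) where
  carrier := {ω | ∀ N < m, ω N = 0}
  add_mem' hω hω' N hN := by rw [Pi.add_apply, hω N hN, hω' N hN, add_zero]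
  zero_mem' _ _ := rfl
  smul_mem' c _ hω N hN := by rw [Pi.smul_apply, hω N hN, smul_zero]

theorem mem_seqFilt {m : ℕ} {ω : OpSeq k A} : ω ∈ seqFilt m ↔ ∀ N < m, ω N = 0 := Iff.rfl

theorem seqFilt_antitone : Antitone (seqFilt (k := k) (A := A)) :=
  fun _ _ hmn _ hω N hN => hω N (lt_of_lt_of_le hN hmn)

theorem seqFilt_zero : seqFilt (k := k) (A := A) 0 = ⊤ := by
  ext ω
  simp [mem_seqFilt]

theorem seqFilt_separated (ω : OpSeq k A) (h : ∀ m, ω ∈ seqFilt m) : ω = 0 :=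
  funext fun N => h (N + 1) N (Nat.lt_succ_self N)

variable (𝒜 : ZMod 2 → Submodule k A) [DirectSum.Decomposition 𝒜]

theorem bracketHom_mem_seqFilt (i j : ℕ) (F : OpSeq k A) (hF : F ∈ seqFilt i) (G : OpSeq k A)
    (hG : G ∈ seqFilt j) : bracketHom 𝒜 F G ∈ seqFilt (i + j) := by
  rw [← seqBracket_eq]
  intro N hN
  refine Finset.sum_eq_zero fun n _ => ?_
  by_cases h : (n : ℕ) < i
  · rw [hF _ h, nrBracket_zero_left]
  · rw [hG _ (by omega), nrBracket_zero_right]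

theorem bracketHom_of_even {F : OpSeq k A} (hF : F ∈ seqOfParity 𝒜 0) (G : OpSeq k A) :
    bracketHom 𝒜 F G = seqWedge 𝒜 F G - seqWedge 𝒜 G F := by
  have h : ∀ d, bracketHom 𝒜 F (seqPart 𝒜 d G) =
      seqWedgeHom 𝒜 F (seqPart 𝒜 d G) - seqWedgeHom 𝒜 (seqPart 𝒜 d G) F := by
    intro d
    rw [bracketHom_of_mem 𝒜 hF (seqPart_mem_seqOfParity 𝒜 d G), superSign_zero_left, one_smul]
  calc bracketHom 𝒜 F G = bracketHom 𝒜 F (∑ d, seqPart 𝒜 d G) := by rw [sum_seqPart]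
    _ = seqWedgeHom 𝒜 F (∑ d, seqPart 𝒜 d G) - seqWedgeHom 𝒜 (∑ d, seqPart 𝒜 d G) F := by
      simp only [map_sum, h, Finset.sum_sub_distrib, LinearMap.sum_apply]
    _ = _ := by
      rw [sum_seqPart]
      rfl

/-- Bracketing with an even element of `D` is a derivation of `D`. -/
theorem bracketHom_leibniz {F G H : OpSeq k A} (hF : F ∈ D 𝒜) (hF0 : F ∈ seqOfParity 𝒜 0)
    (hG : G ∈ D 𝒜) (hH : H ∈ D 𝒜) : bracketHom 𝒜 F (bracketHom 𝒜 G H) =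
      bracketHom 𝒜 (bracketHom 𝒜 F G) H + bracketHom 𝒜 G (bracketHom 𝒜 F H) := by
  rw [← sum_seqPart 𝒜 G]
  simp only [map_sum, LinearMap.sum_apply, ← Finset.sum_add_distrib]
  refine Finset.sum_congr rfl fun d _ => ?_
  rw [bracketHom_jacobi hF (seqPart_mem_D 𝒜 hG d) hH hF0 (seqPart_mem_seqOfParity 𝒜 d G),
    superSign_zero_left, one_smul]

end Filtration

variable {k A : Type*} [Field k] [CharZero k] [NonUnitalRing A] [Module k A] [IsScalarTower k A A]
  [SMulCommClass k A A] (𝒜 : ZMod 2 → Submodule k A) [DirectSum.Decomposition 𝒜]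

theorem muSeq_koszulSeries (n : ℕ) :
    muSeq (A := A) (koszulSeries k) n = (koszulNumber n : k) • mulOp n := by
  have h : ((n + 1).factorial : k) ≠ 0 := Nat.cast_ne_zero.mpr (n + 1).factorial_ne_zero
  rw [muSeq, egf_apply, koszulSeries, coeff_mk, mul_div_cancel₀ _ h, Nat.add_sub_cancel]

/-- The Koszul generator as a linear map. -/
noncomputable def koszulGeneratorHom : OpSeq k A →ₗ[k] OpSeq k A :=
  -bracketHom 𝒜 (muSeq (koszulSeries k))

theorem koszulGeneratorHom_apply (ω : OpSeq k A) :
    koszulGeneratorHom 𝒜 ω = -bracketHom 𝒜 (muSeq (koszulSeries k)) ω := rfl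

/-- The component of index `N` of a bracket sees only components of index at most `N`, so the finite
sum may be replaced by the full sequence `∑ K_n μ_n`. -/
theorem koszulGenerator_eq (ω : OpSeq k A) : koszulGenerator 𝒜 ω = koszulGeneratorHom 𝒜 ω := by
  funext N
  have h1 : ∑ n ∈ Finset.Icc 1 N, (koszulNumber n : k) • rho 𝒜 n ω = bracketHom 𝒜
      (∑ n ∈ Finset.Icc 1 N, (koszulNumber n : k) • Pi.single n (mulOp n)) ω := by
    simp only [rho, seqBracket_eq, map_sum, map_smul, LinearMap.sum_apply, LinearMap.smul_apply]
  have h2 := congrFun h1 N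
  rw [Finset.sum_apply] at h2
  rw [koszulGenerator, koszulGeneratorHom_apply, Pi.neg_apply, neg_inj]
  refine h2.trans ?_
  rw [← seqBracket_eq, ← seqBracket_eq, seqBracket, seqBracket]
  refine Finset.sum_congr rfl fun i _ => ?_
  congr 1
  rw [muSeq_koszulSeries, Finset.sum_apply]
  simp only [Pi.smul_apply]
  rw [Finset.sum_eq_single (i : ℕ)]
  · rw [Pi.single_eq_same]
  · intro n _ hn
    rw [Pi.single_eq_of_ne (Ne.symm hn), smul_zero]
  -- Index `0` is absent from the finite sum, in agreement with the value `koszulNumber 0 = 0`.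
  · intro hi
    have : (i : ℕ) = 0 := by
      have := i.is_le
      simp only [Finset.mem_Icc] at hi
      omega
    rw [this]
    simp [koszulNumber]

theorem koszulExp_apply (ω : OpSeq k A) (N : ℕ) :
    koszulExp 𝒜 ω N = expTrunc (koszulGeneratorHom 𝒜) (N + 1) ω N := by
  rw [koszulExp, expTrunc_apply, Finset.sum_apply]
  refine Finset.sum_congr rfl fun m _ => ?_
  rw [Pi.smul_apply, Module.End.pow_apply]
  congr 1
  exact congrArg (fun g => g^[m] ω N) (funext (koszulGenerator_eq 𝒜))

theorem muSeq_koszulSeries_mem_seqFilt : muSeq (A := A) (koszulSeries k) ∈ seqFilt 1 := by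
  intro N hN
  obtain rfl : N = 0 := by omega
  rw [muSeq_koszulSeries]
  simp [koszulNumber]

theorem koszulGeneratorHom_raises :
    Raises (seqFilt (k := k) (A := A)) (koszulGeneratorHom 𝒜) := by
  intro m ω hω
  rw [add_comm]
  exact Submodule.neg_mem _
    (bracketHom_mem_seqFilt 𝒜 1 m _ muSeq_koszulSeries_mem_seqFilt ω hω)

theorem isExp_koszulExp (ω : OpSeq k A) :
    IsExp seqFilt (koszulGeneratorHom 𝒜) ω (koszulExp 𝒜 ω) := by
  intro m N hN
  have h := (koszulGeneratorHom_raises 𝒜).expTrunc_sub_mem seqFilt_antitone seqFilt_zero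
    (show N + 1 ≤ m from hN) ω N (Nat.lt_succ_self N)
  rw [Pi.sub_apply, koszulExp_apply, ← neg_sub, neg_eq_zero]
  exact h

/-- The inverse exponential. -/
noncomputable def koszulExpNeg (ω : OpSeq k A) : OpSeq k A :=
  fun N => expTrunc (-koszulGeneratorHom 𝒜) (N + 1) ω N

theorem neg_koszulGeneratorHom_raises :
    Raises (seqFilt (k := k) (A := A)) (-koszulGeneratorHom 𝒜) :=
  fun m ω hω => Submodule.neg_mem _ (koszulGeneratorHom_raises 𝒜 m ω hω)

theorem isExp_koszulExpNeg (ω : OpSeq k A) :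
    IsExp seqFilt (-koszulGeneratorHom 𝒜) ω (koszulExpNeg 𝒜 ω) := by
  intro m N hN
  have h := (neg_koszulGeneratorHom_raises 𝒜).expTrunc_sub_mem seqFilt_antitone seqFilt_zero
    (show N + 1 ≤ m from hN) ω N (Nat.lt_succ_self N)
  rw [Pi.sub_apply, koszulExpNeg, ← neg_sub, neg_eq_zero]
  exact h

theorem koszulExpNeg_koszulExp (ω : OpSeq k A) : koszulExpNeg 𝒜 (koszulExp 𝒜 ω) = ω :=
  IsExp.unique seqFilt_separated (isExp_koszulExpNeg 𝒜 _)
    ((isExp_koszulExp 𝒜 ω).neg (koszulGeneratorHom_raises 𝒜) seqFilt_antitone seqFilt_zero)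

theorem koszulExp_koszulExpNeg (ω : OpSeq k A) : koszulExp 𝒜 (koszulExpNeg 𝒜 ω) = ω := by
  have h := (isExp_koszulExpNeg 𝒜 ω).neg (neg_koszulGeneratorHom_raises 𝒜) seqFilt_antitone
    seqFilt_zero
  rw [neg_neg] at h
  exact IsExp.unique seqFilt_separated (isExp_koszulExp 𝒜 _) h

theorem koszulGeneratorHom_mem_seqOfParity [SetLike.GradedMul 𝒜] {c : ZMod 2} {ω : OpSeq k A}
    (hω : ω ∈ seqOfParity 𝒜 c) : koszulGeneratorHom 𝒜 ω ∈ seqOfParity 𝒜 c := by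
  have := bracketHom_mem_seqOfParity (muSeq_mem_seqOfParity 𝒜 (koszulSeries k)) hω
  rw [zero_add] at this
  exact Submodule.neg_mem _ this

theorem koszulExp_mem_seqOfParity [SetLike.GradedMul 𝒜] {c : ZMod 2} {ω : OpSeq k A}
    (hω : ω ∈ seqOfParity 𝒜 c) : koszulExp 𝒜 ω ∈ seqOfParity 𝒜 c := by
  rw [mem_seqOfParity_apply]
  intro n
  rw [koszulExp_apply]
  exact mem_seqOfParity_apply.mp
    (expTrunc_mem _ (fun _ h => koszulGeneratorHom_mem_seqOfParity 𝒜 h) (n + 1) hω) n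

/-! ### The Koszul exponential as an automorphism and its values on linear maps -/

section Antibrackets

theorem wedge_mulOp_zero (f : A →ₗ[k] A) :
    wedge 𝒜 (Nat.sub_add_cancel (le_refl 0)) (mulOp (k := k) 0) (f.compMultilinearMap (mulOp 0)) =
      MultilinearMap.ofSubsingleton k A A (0 : Fin 1) f := by
  refine op_ext 𝒜 fun l => ?_
  by_cases hl : l.length = 0 + 1
  · obtain ⟨x, rfl⟩ := List.length_eq_one_iff.mp hl
    have h : ∀ (a : A) (F : Op k A 0), evOp [a] F = F ![a] := by
      intro a F
      rw [← evOp_ofFn]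
      simp
    rw [evOp_wedge]
    simp only [unsh, unshuffleSum_cons, unshuffleSum_nil, raw_cons, raw_nil, h,
      evOp_compMultilinearMap]
    rw [evOp_of_length_ne (by simp)]
    simp [mulOp_zero_apply]
  · rw [evOp_of_length_ne (by simpa using hl), evOp_of_length_ne (by simpa using hl)]

theorem antiSeq_X_one (f : A →ₗ[k] A) : antiSeq 𝒜 f X 1 = ofLinear f := by
  funext n
  rw [antiSeq_apply, ofLinear]
  rcases n with _ | n
  · rw [Pi.single_eq_same, ← wedge_mulOp_zero 𝒜 f]
    refine (Fin.sum_univ_one _).trans ?_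
    have h : egf 1 (X : k⟦X⟧) * egf 0 (1 : k⟦X⟧) = 1 := by simp [egf_apply]
    exact (congrArg (· • _) h).trans (one_smul k _)
  · rw [Pi.single_eq_of_ne (Nat.succ_ne_zero n)]
    refine Finset.sum_eq_zero fun j _ => ?_
    rw [egf_apply, egf_apply, coeff_X, coeff_one]
    by_cases h : (j : ℕ) = 0
    · rw [if_neg (show n + 1 - (j : ℕ) ≠ 0 by omega)]
      simp
    · rw [if_neg (by omega)]
      simp

/-- The exponential coefficients of `exp - 1` are `1` in positive degree, those of `exp (-X)` are
`(-1)^b`. -/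
theorem antiSeq_exp (f : A →ₗ[k] A) :
    antiSeq 𝒜 f (exp k - 1) (evalNegHom (exp k)) = higherAntibracket 𝒜 f := by
  funext n
  rw [antiSeq_apply, higherAntibracket]
  refine Finset.sum_congr rfl fun j _ => ?_
  have h1 : ((j + 1 : ℕ).factorial : k) ≠ 0 := Nat.cast_ne_zero.mpr (Nat.factorial_ne_zero _)
  have h2 : ((n - j : ℕ).factorial : k) ≠ 0 := Nat.cast_ne_zero.mpr (Nat.factorial_ne_zero _)
  rw [wedge, egf_apply, egf_apply, map_sub, coeff_one, if_neg (Nat.succ_ne_zero _), sub_zero,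
    coeff_exp_eq, mul_inv_cancel₀ h1, one_mul, evalNegHom, coeff_rescale, coeff_exp_eq,
    mul_comm, mul_assoc, inv_mul_cancel₀ h2, mul_one]

variable {𝒜} (hcomm : ∀ c d : ZMod 2, ∀ a ∈ 𝒜 c, ∀ b ∈ 𝒜 d, a * b = superSign k c d • (b * a))
include hcomm

theorem koszulGeneratorHom_mem_D {ω : OpSeq k A} (hω : ω ∈ D 𝒜) :
    koszulGeneratorHom 𝒜 ω ∈ D 𝒜 :=
  Submodule.neg_mem _ (bracketHom_mem_D (muSeq_mem_D hcomm (koszulSeries k)) hω)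

theorem koszulExp_mem_D {ω : OpSeq k A} (hω : ω ∈ D 𝒜) : koszulExp 𝒜 ω ∈ D 𝒜 := by
  rw [mem_D_apply]
  intro n
  rw [koszulExp_apply]
  exact mem_D_apply.mp
    (expTrunc_mem _ (fun _ h => koszulGeneratorHom_mem_D hcomm h) (n + 1) hω) n

theorem koszulExpNeg_mem_D {ω : OpSeq k A} (hω : ω ∈ D 𝒜) : koszulExpNeg 𝒜 ω ∈ D 𝒜 := by
  rw [mem_D_apply]
  intro n
  exact mem_D_apply.mp (expTrunc_mem _
    (fun _ h => Submodule.neg_mem _ (koszulGeneratorHom_mem_D hcomm h)) (n + 1) hω) n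

variable [SetLike.GradedMul 𝒜]

theorem koszulExp_bracketHom {F G : OpSeq k A} (hF : F ∈ D 𝒜) (hG : G ∈ D 𝒜) :
    koszulExp 𝒜 (bracketHom 𝒜 F G) = bracketHom 𝒜 (koszulExp 𝒜 F) (koszulExp 𝒜 G) := by
  refine IsExp.unique seqFilt_separated (isExp_koszulExp 𝒜 _) ?_
  -- The orbits must stay in `D`, where the derivation property holds.
  have hpow : ∀ (ω : OpSeq k A), ω ∈ D 𝒜 → ∀ i, (koszulGeneratorHom 𝒜 ^ i) ω ∈ D 𝒜 := by
    intro ω hω i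
    induction i with
    | zero => exact hω
    | succ i ih =>
      rw [pow_succ', Module.End.mul_apply]
      exact koszulGeneratorHom_mem_D hcomm ih
  refine IsExp.bilinear (bracketHom 𝒜) (bracketHom_mem_seqFilt 𝒜) seqFilt_antitone seqFilt_zero
    seqFilt_zero (koszulGeneratorHom_raises 𝒜) (koszulGeneratorHom_raises 𝒜) (fun i j => ?_)
    (isExp_koszulExp 𝒜 F) (isExp_koszulExp 𝒜 G)
  rw [pow_succ' _ i, pow_succ' _ j, Module.End.mul_apply, Module.End.mul_apply,
    koszulGeneratorHom_apply, bracketHom_leibniz 𝒜 (muSeq_mem_D hcomm _)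
      (muSeq_mem_seqOfParity 𝒜 _) (hpow F hF i) (hpow G hG j), koszulGeneratorHom_apply,
    koszulGeneratorHom_apply]
  simp only [map_neg, LinearMap.neg_apply, neg_add]

theorem isLieSuperalgebraAut_koszulExp : IsLieSuperalgebraAut (D 𝒜) (seqOfParity 𝒜)
    (seqBracket 𝒜) (koszulExp 𝒜) where
  bijOn := Set.InvOn.bijOn (f' := koszulExpNeg 𝒜)
    ⟨fun ω _ => koszulExpNeg_koszulExp 𝒜 ω, fun ω _ => koszulExp_koszulExpNeg 𝒜 ω⟩
    (fun _ h => koszulExp_mem_D hcomm h) (fun _ h => koszulExpNeg_mem_D hcomm h)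
  map_add x _ y _ := by
    funext N
    simp only [koszulExp_apply, map_add, Pi.add_apply]
  map_smul a x _ := by
    funext N
    simp only [koszulExp_apply, map_smul, Pi.smul_apply]
  map_parity c x hx := koszulExp_mem_seqOfParity 𝒜 hx.2
  map_bracket x hx y hy := by
    rw [seqBracket_eq, seqBracket_eq]
    exact koszulExp_bracketHom hcomm hx hy

/-- Multiplying outside contributes `-Q K'`, inserting products contributes `K P'` and `K Q'`. The
combination `K Q' - K' Q` is the bracket of the vector fields `K d/dX` and `Q d/dX`. -/
theorem koszulGeneratorHom_antiSeq (f : A →ₗ[k] A) (P Q : k⟦X⟧) :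
    koszulGeneratorHom 𝒜 (antiSeq 𝒜 f P Q) =
      antiSeq 𝒜 f (twistedField 0 (koszulSeries k) P) Q +
        antiSeq 𝒜 f P (twistedField (-1) (koszulSeries k) Q) := by
  have h1 : constantCoeff (koszulSeries k) = 0 :=
    X_dvd_iff.mp ((dvd_pow_self X two_ne_zero).trans (X_sq_dvd_koszulSeries k))
  rw [koszulGeneratorHom_apply, bracketHom_of_even 𝒜 (muSeq_mem_seqOfParity 𝒜 _),
    seqWedge_muSeq_antiSeq hcomm, seqWedge_antiSeq_muSeq hcomm f h1, twistedField_apply,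
    twistedField_apply, zero_smul, add_zero, neg_one_smul, map_add, map_neg, mul_comm Q]
  abel

/-- The exponential of the Koszul generator sends a linear map to its higher antibrackets. -/
theorem koszulExp_ofLinear (f : A →ₗ[k] A) :
    koszulExp 𝒜 (ofLinear f) = higherAntibracket 𝒜 f := by
  rw [← antiSeq_X_one 𝒜 f, ← antiSeq_exp 𝒜 f, ← powExp_koszulSeries_X,
    ← powExp_koszulSeries_neg_one]
  have hK := X_sq_dvd_koszulSeries k
  have hd0 := twistedField_raises hK (0 : k)
  have hd1 := twistedField_raises hK (-1 : k)
  -- The index of an operator is one less than its number of variables, so series of orders `i` and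
  -- `j` give a sequence starting at index `i + j - 1`; the filtration is shifted accordingly.
  refine IsExp.unique (Φ := fun m => seqFilt (m - 1)) (d := koszulGeneratorHom 𝒜)
    (fun ω h => seqFilt_separated ω fun m => h (m + 1))
    (fun m => seqFilt_antitone (Nat.sub_le m 1) (isExp_koszulExp 𝒜 _ m)) ?_
  refine IsExp.bilinear (antiSeq 𝒜 f) ?_ (fun m n hmn => seqFilt_antitone (by omega))
    powFilt_zero powFilt_zero hd0 hd1 (fun i j => ?_) (isExp_powExp hd0 X) (isExp_powExp hd1 1)
  · intro i j P hP Q hQ N hN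
    rw [mem_powFilt, X_pow_dvd_iff] at hP hQ
    rw [antiSeq_apply]
    refine Finset.sum_eq_zero fun n _ => ?_
    rw [egf_apply, egf_apply]
    by_cases h : (n : ℕ) + 1 < i
    · rw [hP _ h, mul_zero, zero_mul, zero_smul]
    · rw [hQ (N - n) (by omega), mul_zero, mul_zero, zero_smul]
  · rw [koszulGeneratorHom_antiSeq hcomm, pow_succ' _ i, pow_succ' _ j, Module.End.mul_apply,
      Module.End.mul_apply]

end Antibrackets

end Exponential

/-! ### Supercommutators -/

section Commutator

variable {k A : Type*} [Field k] [AddCommGroup A] [Module k A]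
  (𝒜 : ZMod 2 → Submodule k A)

theorem ev_ofLinear_singleton (f : A →ₗ[k] A) (a : A) : ev [a] (ofLinear f) = f a := by
  rw [ev_eq_evOp (n := 0) rfl, ofLinear, Pi.single_eq_same, evOp_apply, dif_pos (by simp)]
  rfl

theorem ev_ofLinear_of_length_ne (f : A →ₗ[k] A) {l : List A} (h : l.length ≠ 1) :
    ev l (ofLinear f) = 0 := by
  rcases l with _ | ⟨a, _ | ⟨b, l⟩⟩
  · exact ev_nil _
  · simp at h
  · rw [ev_eq_evOp (n := l.length + 1) rfl, ofLinear, Pi.single_eq_of_ne (Nat.succ_ne_zero _),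
      map_zero]

theorem ofLinear_mem_D (f : A →ₗ[k] A) : ofLinear f ∈ D 𝒜 := by
  rw [mem_D_iff]
  intro l x y m
  simp only
  rw [ev_ofLinear_of_length_ne _ (by simp; omega), ev_ofLinear_of_length_ne _ (by simp; omega),
    smul_zero]

theorem ofLinear_mem_seqOfParity {c : ZMod 2} {f : A →ₗ[k] A}
    (hf : IsLinearOfParity 𝒜 c f) : ofLinear f ∈ seqOfParity 𝒜 c := by
  rw [mem_seqOfParity_iff]
  intro l
  by_cases hl : l.length = 1
  · obtain ⟨x, rfl⟩ := List.length_eq_one_iff.mp hl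
    rw [raw_cons, raw_nil, ev_ofLinear_singleton]
    simpa using hf x.1 _ x.2.2
  · rw [ev_ofLinear_of_length_ne _ (by simpa using hl)]
    exact Submodule.zero_mem _

/-- `ofLinear` as a linear map. -/
def ofLinearHom : (A →ₗ[k] A) →ₗ[k] OpSeq k A where
  toFun := ofLinear
  map_add' f g := by
    rw [ofLinear, ofLinear, ofLinear, ← Pi.single_add]
    rfl
  map_smul' c f := by
    rw [ofLinear, ofLinear, RingHom.id_apply, ← Pi.single_smul]
    rfl

theorem ofLinearHom_apply (f : A →ₗ[k] A) : ofLinearHom f = ofLinear f := rfl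

variable [DirectSum.Decomposition 𝒜]

theorem seqWedge_ofLinear (f g : A →ₗ[k] A) :
    seqWedge 𝒜 (ofLinear f) (ofLinear g) = ofLinear (f ∘ₗ g) := by
  refine seq_ext 𝒜 fun l => ?_
  rw [ev_seqWedge]
  by_cases hl : l.length = 1
  · obtain ⟨x, rfl⟩ := List.length_eq_one_iff.mp hl
    simp only [unsh, unshuffleSum_cons, unshuffleSum_nil, raw_cons, raw_nil,
      ev_ofLinear_singleton, ev_nil, LinearMap.comp_apply]
    rw [ev_ofLinear_of_length_ne f (l := [0, (x.2 : A)]) (by simp), smul_zero, add_zero]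
  · rw [ev_ofLinear_of_length_ne _ (by simpa using hl)]
    refine (unshuffleSum_congr k _ fun a b hab => ?_).trans (unshuffleSum_zero (M := A) k _ l)
    have hlen := hab.length_eq
    rw [List.length_append] at hlen
    by_cases hb : b.length = 0
    · rw [ev_ofLinear_of_length_ne g (by rw [length_raw]; omega), ← head_apply, map_zero]
    · rw [ev_ofLinear_of_length_ne f (by simpa using hb)]

theorem seqPart_ofLinear (c : ZMod 2) (f : A →ₗ[k] A) :
    seqPart 𝒜 c (ofLinear f) = ofLinear (linearPart 𝒜 c f) := by
  refine seq_ext 𝒜 fun l => ?_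
  rw [ev_seqPart]
  by_cases hl : l.length = 1
  · obtain ⟨x, rfl⟩ := List.length_eq_one_iff.mp hl
    simp only [raw_cons, raw_nil, ev_ofLinear_singleton, linearPart, LinearMap.sum_apply,
      LinearMap.comp_apply, parityProj_of_mem 𝒜 x.2.2]
    rw [Finset.sum_eq_single x.1]
    · simp
    · intro d _ hd
      rw [if_neg hd, map_zero, map_zero]
    · simp
  · rw [ev_ofLinear_of_length_ne _ (by simpa using hl),
      ev_ofLinear_of_length_ne _ (by simpa using hl), map_zero]

theorem bracketHom_ofLinear (f g : A →ₗ[k] A) :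
    bracketHom 𝒜 (ofLinear f) (ofLinear g) = ofLinear (superCommutator 𝒜 f g) := by
  rw [bracketHom_eq_sum, superCommutator, ← ofLinearHom_apply (Finset.sum _ _)]
  simp only [seqPart_ofLinear, seqWedge_ofLinear, map_sum, map_sub, map_smul, ofLinearHom_apply]

end Commutator

end Antibracket

/-! ### Transport from linear maps to antibrackets -/

theorem mainTheorem5 {k A : Type*} [Field k] [CharZero k] [NonUnitalRing A] [Module k A]
    [IsScalarTower k A A] [SMulCommClass k A A]
    (𝒜 : ZMod 2 → Submodule k A) [DirectSum.Decomposition 𝒜] [SetLike.GradedMul 𝒜]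
    (hcomm : ∀ c d : ZMod 2, ∀ a ∈ 𝒜 c, ∀ b ∈ 𝒜 d,
      a * b = Antibracket.superSign k c d • (b * a)) :
    (∀ f : A →ₗ[k] A, Antibracket.higherAntibracket 𝒜 f ∈ Antibracket.D 𝒜) ∧
    (∀ (f g : A →ₗ[k] A) (n : ℕ),
      Antibracket.higherAntibracket 𝒜 (Antibracket.superCommutator 𝒜 f g) n =
        ∑ i : Fin (n + 1), Antibracket.nrBracket 𝒜 (Nat.add_sub_of_le i.is_le)
          (Antibracket.higherAntibracket 𝒜 f i) (Antibracket.higherAntibracket 𝒜 g (n - i))) ∧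
    Antibracket.IsLieSuperalgebra (Antibracket.D 𝒜) (Antibracket.seqOfParity 𝒜)
      (Antibracket.seqBracket 𝒜) ∧
    Antibracket.IsLieSuperalgebraAut (Antibracket.D 𝒜) (Antibracket.seqOfParity 𝒜)
      (Antibracket.seqBracket 𝒜) (Antibracket.koszulExp 𝒜) ∧
    (∀ f : A →ₗ[k] A,
      Antibracket.koszulExp 𝒜 (Antibracket.ofLinear f) = Antibracket.higherAntibracket 𝒜 f) ∧
    (∀ Δ : A →ₗ[k] A, Antibracket.IsLinearOfParity 𝒜 1 Δ → Δ ∘ₗ Δ = 0 →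
      (∀ n : ℕ, ∑ i : Fin (n + 1), Antibracket.nrBracket 𝒜 (Nat.add_sub_of_le i.is_le)
        (Antibracket.higherAntibracket 𝒜 Δ i) (Antibracket.higherAntibracket 𝒜 Δ (n - i)) = 0) ∧
      Antibracket.IsLInfinityStructure 𝒜 (Antibracket.higherAntibracket 𝒜 Δ)) := by
  have hD : ∀ f : A →ₗ[k] A, Antibracket.higherAntibracket 𝒜 f ∈ Antibracket.D 𝒜 := fun f => by
    rw [← Antibracket.koszulExp_ofLinear hcomm]
    exact Antibracket.koszulExp_mem_D hcomm (Antibracket.ofLinear_mem_D 𝒜 f)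
  have hbr : ∀ f g : A →ₗ[k] A,
      Antibracket.koszulExp 𝒜 (Antibracket.bracketHom 𝒜 (Antibracket.ofLinear f)
        (Antibracket.ofLinear g)) =
      Antibracket.seqBracket 𝒜 (Antibracket.higherAntibracket 𝒜 f)
        (Antibracket.higherAntibracket 𝒜 g) := fun f g => by
    rw [Antibracket.koszulExp_bracketHom hcomm (Antibracket.ofLinear_mem_D 𝒜 f)
      (Antibracket.ofLinear_mem_D 𝒜 g), Antibracket.koszulExp_ofLinear hcomm,
      Antibracket.koszulExp_ofLinear hcomm, Antibracket.seqBracket_eq]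
  refine ⟨hD, ?_, Antibracket.isLieSuperalgebra_D 𝒜,
    Antibracket.isLieSuperalgebraAut_koszulExp hcomm, Antibracket.koszulExp_ofLinear hcomm, ?_⟩
  · intro f g n
    rw [← Antibracket.koszulExp_ofLinear hcomm, ← Antibracket.bracketHom_ofLinear, hbr]
    rfl
  · intro Δ hodd hsq
    have hodd' := Antibracket.ofLinear_mem_seqOfParity 𝒜 hodd
    have hΦ : Antibracket.higherAntibracket 𝒜 Δ ∈ Antibracket.seqOfParity 𝒜 1 := by
      rw [← Antibracket.koszulExp_ofLinear hcomm]
      exact Antibracket.koszulExp_mem_seqOfParity 𝒜 hodd'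
    have h0 : Antibracket.seqBracket 𝒜 (Antibracket.higherAntibracket 𝒜 Δ)
        (Antibracket.higherAntibracket 𝒜 Δ) = 0 := by
      rw [← hbr, Antibracket.bracketHom_of_mem 𝒜 hodd' hodd', Antibracket.seqWedgeHom_apply,
        Antibracket.seqWedge_ofLinear, hsq, ← Antibracket.ofLinearHom_apply, map_zero, smul_zero,
        sub_zero]
      funext N
      rw [Antibracket.koszulExp_apply, map_zero]
    have h1 : Antibracket.seqWedge 𝒜 (Antibracket.higherAntibracket 𝒜 Δ)
        (Antibracket.higherAntibracket 𝒜 Δ) = 0 := by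
      rw [Antibracket.seqBracket_eq, Antibracket.bracketHom_of_mem 𝒜 hΦ hΦ,
        Antibracket.seqWedgeHom_apply] at h0
      -- For an odd sequence the bracket with itself is twice its `⊼`-square, and `2` is invertible.
      have hs : Antibracket.superSign k 1 1 = -1 := by simp [Antibracket.superSign]
      rw [hs, neg_one_smul, sub_neg_eq_add, ← two_smul k] at h0
      exact (smul_eq_zero.mp h0).resolve_left two_ne_zero
    exact ⟨fun n => congrFun h0 n, hD Δ, hΦ, fun n => congrFun h1 n⟩
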